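/- Let $k$ be an algebraically closed field of characteristic $0$, and let $A$ be the coordinate ring of a reduced algebroid curve over $k$, that is, a reduced complete Noetherian local $k$-algebra of Krull dimension $1$ with residue field $k$ and maximal ideal $\mathfrak m_A$. Let $\mathfrak p_1,\dots,\mathfrak p_r$ be the minimal primes of $A$, and let $\tilde A$ be the normalization of $A$, i.e. its integral closure in its total ring of fractions. By coordinates $t=(t_1,\dots,t_r)$ on $\tilde A$ we mean an isomorphism of $k$-algebras $\tilde A\cong\prod_{i=1}^r k[[t_i]]$ such that $\mathfrak p_i$ is the kernel of the composite map $A\to\tilde A\to k[[t_i]]$ for each $i$. Let $\chi\in\operatorname{Der}_k(A)$ be a $k$-linear derivation such that the ideal generated by its image is the maximal ideal: $A\cdot\chi(A)=\mathfrak m_A$. Then: 1. $\chi$ lifts to a unique derivation $\tilde\chi\in\operatorname{Der}_k(\tilde A)$, and for suitable coordinates $t$ on $\tilde A$ there is $\gamma\in k^r$ with $\tilde\chi=\gamma\cdot t\partial_t$, that is, $\tilde\chi$ acts on the $i$-th factor $k[[t_i]]$ as $\gamma_i t_i\partial_{t_i}$ for $i=1,\dots,r$. 2. $\chi$ is diagonalizable,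 that is, the ideal $\mathfrak m_A$ is generated by eigenvectors of $\chi$, and all eigenvalues of $\chi$ on $\mathfrak m_A$ are non-zero. 3. $\chi$ can be chosen with positive integer eigenvalues: there is a diagonalizable $\chi'\in\operatorname{Der}_k(A)$ with $A\cdot\chi'(A)=\mathfrak m_A$ such that all eigenvalues of $\chi'$ on $\mathfrak m_A$ lie in $\mathbb N_+=\{1,2,3,\dots\}$. -/

import Mathlib

open IsLocalRing

/-- A local `k`-algebra `A` is the coordinate ring of a reduced algebroid curve over `k`: it is a
complete Noetherian local `k`-algebra with residue field `k` (equivalently, a quotient of some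
`k[[x₁, …, xₙ]]`), reduced and of Krull dimension one. -/
structure IsReducedAlgebroidCurve (k A : Type*) [Field k] [CommRing A] [IsLocalRing A]
    [Algebra k A] : Prop where
  noetherian : IsNoetherianRing A
  complete : IsAdicComplete (maximalIdeal A) A
  residue : Function.Bijective (algebraMap k (ResidueField A))
  reduced : IsReduced A
  dim_one : ringKrullDim A = 1

/-- The normalization of `A`: its integral closure in its total ring of fractions. -/
abbrev Normalization (A : Type*) [CommRing A] : Type _ :=
  ↥(integralClosure A (FractionRing A))

/-- A choice of coordinates (local parameters) `t_p`, one for each branch, that is, for each minimal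
prime `p` of `A`: an identification of `k`-algebras of the normalization of `A` with the product
over the branches of the power series rings `k[[t_p]]`, such that the kernel of the induced map from
`A` to the factor with index `p` is `p`. -/
structure NormalizationCoordinates (k A : Type*) [Field k] [CommRing A] [Algebra k A] where
  toAlgEquiv : Normalization A ≃ₐ[k] (minimalPrimes A → PowerSeries k)
  branch : ∀ (a : A) (p : minimalPrimes A),
    toAlgEquiv (algebraMap A (Normalization A) a) p = 0 ↔ a ∈ (p : Ideal A)

/-- `D` is a lift of the derivation `χ` of `A` to the normalization of `A`. -/
def IsLiftToNormalization {k A : Type*} [Field k] [CommRing A] [Algebra k A]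
    (χ : Derivation k A A) (D : Derivation k (Normalization A) (Normalization A)) : Prop :=
  ∀ a : A, D (algebraMap A (Normalization A) a) = algebraMap A (Normalization A) (χ a)

/-- In the coordinates `t`, the derivation `D` equals `γ · t ∂_t`, with a constant `γ p` of `k` for
each branch `p`. -/
def IsEulerIn {k A : Type*} [Field k] [CommRing A] [Algebra k A]
    (t : NormalizationCoordinates k A) (γ : minimalPrimes A → k)
    (D : Derivation k (Normalization A) (Normalization A)) : Prop :=
  ∀ (x : Normalization A) (p : minimalPrimes A),
    t.toAlgEquiv (D x) p =
      γ p • (PowerSeries.X * PowerSeries.derivative k (t.toAlgEquiv x p))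

/-- `A · χ(A) = 𝔪_A`: the ideal generated by the image of `χ` is the maximal ideal. -/
def GeneratesMaximalIdeal {k A : Type*} [Field k] [CommRing A] [IsLocalRing A] [Algebra k A]
    (χ : Derivation k A A) : Prop :=
  Ideal.span (Set.range χ) = maximalIdeal A

/-- `χ` is diagonalizable: the maximal ideal is generated by eigenvectors of `χ`. -/
def IsDiagonalizableDerivation {k A : Type*} [Field k] [CommRing A] [IsLocalRing A] [Algebra k A]
    (χ : Derivation k A A) : Prop :=
  Ideal.span {x : A | x ∈ maximalIdeal A ∧
    ∃ c : k, Module.End.HasEigenvector (χ : A →ₗ[k] A) c x} = maximalIdeal A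

/-- The set of all eigenvalues of `χ` on the maximal ideal. -/
def eigenvaluesOnMaximalIdeal {k A : Type*} [Field k] [CommRing A] [IsLocalRing A] [Algebra k A]
    (χ : Derivation k A A) : Set k :=
  {c : k | ∃ x ∈ maximalIdeal A, Module.End.HasEigenvector (χ : A →ₗ[k] A) c x}

/-!
The normalization of a reduced algebroid curve `A` is a product of power series rings, one for
each branch. Indeed, `A` is finite over `k⟦x⟧` for a parameter `x`, by completeness
(`IsReducedAlgebroidCurve.finite_powerSeries`). The integral closure of a branch `A ⧸ p` is then a
finite module over `k⟦x⟧`, as the characteristic is zero; it is a complete Dedekind domain, hence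
local since idempotents lift, hence a complete discrete valuation ring with residue field `k`, that
is, `k⟦t⟧` (`PowerSeries.nonempty_algEquiv_of_finite`). Finiteness also gives the conductor: some
`t ^ N` times the product is contained in `A`. This is recorded in `CurveParametrization`, and
`CurveParametrization.exists_coordinates` identifies the product with the normalization.

On each branch, `χ` is a multiple of `∂`, because both are continuous and the conductor makes all
high powers of `t` available. The least order `e > 0` on the branch of an element of the maximal
ideal is not lowered by `χ`, since `χ` maps to the maximal ideal, and it is not raised for all
elements, since the image of `χ` generates the maximal ideal. As `∂` lowers positive orders by
exactly one, `χ = h · t ∂` with a unit `h` (`CurveParametrization.exists_isUnit_derivation_eq`).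
Integrating a linear differential equation gives a new parameter in which `χ = γ · t ∂` with the
constant `γ = h(0) ≠ 0` (`PowerSeries.exists_algEquiv_linearize`). This is the lift of `χ` to the
normalization, and it is the only one as the normalization has the same fractions as `A`.

Hence `χ` multiplies the coefficient of `t_p ^ n` by `γ p * n`. Modulo the conductor only finitely
many coefficients matter, so that Lagrange interpolation polynomials in `χ` decompose an element of
the maximal ideal into eigenvectors lying in `A`, up to a remainder of high order
(`CurveParametrization.IsEuler.exists_eq_sum_eigenvectors_add`). Nakayama's lemma removes the
remainder. The eigenvalues are of the form `γ p * n` with `n > 0`, so they do not vanish.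

An eigenvector only involves branches whose `γ p` are commensurable. Replacing `γ` by positive
integers that are proportional to it on each commensurability class (`exists_pos_nat_weights`)
multiplies eigenvectors of `χ` by constants, so the new vector field preserves `A` as well
(`CurveParametrization.IsEuler.exists_isEuler_of_weights`).
-/

/-! ### Power series and complete modules -/

/-- Evaluation of power series at a topologically nilpotent element `t` of a complete algebra. -/
theorem exists_algHom_powerSeries_X_eq {k S : Type*} [Field k] [CommRing S] [Algebra k S]
    (I : Ideal S) [IsAdicComplete I S] (t : S) (e : ℕ) (ht : t ^ e ∈ I) :
    ∃ f : PowerSeries k →ₐ[k] S, f PowerSeries.X = t := by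
  -- `n`-th approximation: evaluate the truncation in degree `e * n` modulo `I ^ n`
  have key : ∀ (n : ℕ) (p : Polynomial k), Polynomial.X ^ (e * n) ∣ p →
      Ideal.Quotient.mk (I ^ n) (Polynomial.aeval t p) = 0 := by
    rintro n p ⟨q, rfl⟩
    rw [Ideal.Quotient.eq_zero_iff_mem, map_mul, map_pow, Polynomial.aeval_X, pow_mul]
    exact Ideal.mul_mem_right _ _ (Ideal.pow_mem_pow ht n)
  have key' : ∀ (n : ℕ) (p q : Polynomial k), (∀ d < e * n, p.coeff d = q.coeff d) →
      Ideal.Quotient.mk (I ^ n) (Polynomial.aeval t p) =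
        Ideal.Quotient.mk (I ^ n) (Polynomial.aeval t q) := by
    intro n p q h
    rw [← sub_eq_zero, ← map_sub, ← map_sub]
    refine key n _ (Polynomial.X_pow_dvd_iff.2 fun d hd => ?_)
    rw [Polynomial.coeff_sub, h d hd, sub_self]
  let F : (n : ℕ) → PowerSeries k →ₐ[k] S ⧸ I ^ n := fun n =>
    { toFun := fun g => Ideal.Quotient.mk (I ^ n)
        (Polynomial.aeval t (PowerSeries.trunc (e * n) g))
      map_one' := by
        rw [key' n _ 1 fun d hd => ?_]
        · simp
        · rw [PowerSeries.coeff_trunc, if_pos hd, ← Polynomial.coeff_coe, Polynomial.coe_one]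
      map_mul' := fun g h => by
        rw [← map_mul, ← map_mul]
        refine key' n _ _ fun d hd => ?_
        rw [PowerSeries.coeff_trunc, if_pos hd, Polynomial.coeff_mul, PowerSeries.coeff_mul]
        refine Finset.sum_congr rfl fun x hx => ?_
        have := Finset.HasAntidiagonal.mem_antidiagonal.1 hx
        rw [PowerSeries.coeff_trunc, PowerSeries.coeff_trunc, if_pos (by omega),
          if_pos (by omega)]
      map_zero' := by simp
      map_add' := fun g h => by simp
      commutes' := fun r => by
        rw [key' n _ (Polynomial.C r) fun d hd => ?_]
        · simp
        · rw [PowerSeries.coeff_trunc, if_pos hd, ← Polynomial.coeff_coe, Polynomial.coe_C]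
          rfl }
  have hF : ∀ {m n : ℕ} (hle : m ≤ n),
      (Ideal.Quotient.factorₐ k (Ideal.pow_le_pow_right hle)).comp (F n) = F m := by
    intro m n hle
    ext g
    change Ideal.Quotient.mk (I ^ m) _ = Ideal.Quotient.mk (I ^ m) _
    refine key' m _ _ fun d hd => ?_
    rw [PowerSeries.coeff_trunc, PowerSeries.coeff_trunc, if_pos hd,
      if_pos (hd.trans_le (Nat.mul_le_mul_left e hle))]
  refine ⟨IsAdicComplete.liftAlgHom I F hF, ?_⟩
  refine (IsHausdorff.eq_iff_smodEq (I := I)).2 fun n => ?_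
  rw [smul_eq_mul, Ideal.mul_top, SModEq.def]
  change Ideal.Quotient.mk (I ^ n) _ = Ideal.Quotient.mk (I ^ n) _
  rw [IsAdicComplete.mk_liftAlgHom]
  change Ideal.Quotient.mk (I ^ n) _ = _
  by_cases h : e * n ≤ 1
  · -- then `t` itself lies in `I ^ n`
    have h0 : Ideal.Quotient.mk (I ^ n) t = 0 := by
      have := key n Polynomial.X (by simpa using pow_dvd_pow Polynomial.X h)
      simpa using this
    rw [h0]
    have h1 : PowerSeries.trunc (e * n) (PowerSeries.X : PowerSeries k) = 0 := by
      ext d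
      rw [PowerSeries.coeff_trunc]
      split_ifs with hd
      · rw [PowerSeries.coeff_X, if_neg (by omega)]; simp
      · simp
    rw [h1]; simp
  · rw [key' n _ Polynomial.X fun d hd => ?_]
    · simp
    · rw [PowerSeries.coeff_trunc, if_pos hd, ← Polynomial.coeff_coe, Polynomial.coe_X]

theorem PowerSeries.injective_of_map_X_ne_zero {k D : Type*} [Field k] [CommRing D] [IsDomain D]
    (f : PowerSeries k →+* D) (hf : f PowerSeries.X ≠ 0) : Function.Injective f := by
  rw [injective_iff_map_eq_zero]
  intro g hg
  by_contra hg0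
  obtain ⟨n, v, hv⟩ := IsDiscreteValuationRing.eq_unit_mul_pow_irreducible hg0
    PowerSeries.X_prime.irreducible
  rw [hv, map_mul, map_pow] at hg
  exact mul_ne_zero ((v.isUnit.map f).ne_zero) (pow_ne_zero n hf) hg

theorem IsPrecomplete.pi {R ι : Type*} [CommRing R] [Finite ι] (I : Ideal R)
    [IsPrecomplete I R] : IsPrecomplete I (ι → R) := by
  classical
  cases nonempty_fintype ι
  have hmem : ∀ (n : ℕ) (x : ι → R), x ∈ (I ^ n • ⊤ : Submodule R (ι → R)) ↔
      ∀ i, x i ∈ (I ^ n • ⊤ : Ideal R) := by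
    intro n x
    rw [smul_eq_mul, Ideal.mul_top]
    constructor
    · intro hx i
      have := Submodule.mem_map_of_mem (f := LinearMap.proj (R := R) (φ := fun _ : ι => R) i) hx
      rw [Submodule.map_smul''] at this
      simpa using Submodule.smul_mono le_rfl le_top this
    · intro hx
      rw [pi_eq_sum_univ' x]
      exact Submodule.sum_mem _ fun i _ => Submodule.smul_mem_smul (hx i) trivial
  refine ⟨fun f hf => ?_⟩
  have h : ∀ i, ∃ L : R, ∀ n, f n i ≡ L [SMOD (I ^ n • ⊤ : Ideal R)] := fun i =>
    IsPrecomplete.prec' (fun n => f n i) fun hmn => by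
      have := hf hmn
      rw [SModEq.sub_mem] at this ⊢
      exact (hmem _ _).1 this i
  choose L hL using h
  refine ⟨L, fun n => ?_⟩
  rw [SModEq.sub_mem, hmem]
  intro i
  have := hL i n
  rwa [SModEq.sub_mem] at this

theorem IsPrecomplete.of_finite {R M : Type*} [CommRing R] [AddCommGroup M] [Module R M]
    [Module.Finite R M] (I : Ideal R) [IsPrecomplete I R] : IsPrecomplete I M := by
  obtain ⟨n, g, hg⟩ := Module.Finite.exists_fin' R M
  have := IsPrecomplete.pi (ι := Fin n) I
  rw [← AdicCompletion.of_surjective_iff]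
  intro y
  obtain ⟨x, rfl⟩ := AdicCompletion.map_surjective I hg y
  obtain ⟨z, rfl⟩ := AdicCompletion.of_surjective I _ x
  exact ⟨g z, by rw [AdicCompletion.map_of]⟩

/-- A separated module over a complete ring is generated by lifts of generators modulo `I`. -/
theorem Submodule.eq_top_of_sup_smul_eq_top {R M : Type*} [CommRing R] [AddCommGroup M]
    [Module R M] (I : Ideal R) [IsPrecomplete I R] [IsHausdorff I M] (N : Submodule R M)
    (hN : N.FG) (h : N ⊔ I • ⊤ = ⊤) : N = ⊤ := by
  have : Module.Finite R N := Module.Finite.iff_fg.2 hN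
  have : IsPrecomplete I N := IsPrecomplete.of_finite I
  rw [← Submodule.range_subtype N, LinearMap.range_eq_top]
  refine surjective_of_mkQ_comp_surjective (I := I) fun y => ?_
  obtain ⟨y, rfl⟩ := Submodule.mkQ_surjective _ y
  have hy : y ∈ N ⊔ I • ⊤ := by rw [h]; trivial
  obtain ⟨a, ha, b, hb, rfl⟩ := Submodule.mem_sup.1 hy
  refine ⟨⟨a, ha⟩, ?_⟩
  simp only [LinearMap.comp_apply, Submodule.subtype_apply, map_add]
  rw [Submodule.mkQ_apply _ b, (Submodule.Quotient.mk_eq_zero _).2 hb, add_zero]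

/-! ### Normalization of a branch -/

/-- Idempotents of `C ⧸ I` lift to `C`, and an Artinian ring without nontrivial idempotents is
local. -/
theorem IsLocalRing.of_isAdicComplete_of_isArtinianRing_quotient {C : Type*} [CommRing C]
    [IsDomain C] (I : Ideal C) [IsAdicComplete I C] [IsArtinianRing (C ⧸ I)] :
    IsLocalRing C := by
  have hjac : ∀ M : Ideal C, M.IsMaximal → I ≤ M := fun M hM =>
    (IsAdicComplete.le_jacobson_bot I).trans (sInf_le ⟨bot_le, hM⟩)
  obtain ⟨M₀, hM₀⟩ := Ideal.exists_maximal C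
  refine IsLocalRing.of_unique_max_ideal ⟨M₀, hM₀, fun M₂ hM₂ => ?_⟩
  by_contra hne
  obtain ⟨a, ha₁, ha₂⟩ : ∃ a ∈ M₀, a ∉ M₂ := by
    by_contra! hcon
    exact hne (hM₀.eq_of_le hM₂.ne_top hcon).symm
  -- some power of `a` generates an idempotent modulo `I`
  obtain ⟨n, y, hy⟩ := IsArtinian.exists_pow_succ_smul_dvd (Ideal.Quotient.mk I a)
    (1 : C ⧸ I)
  obtain ⟨b, rfl⟩ := Ideal.Quotient.mk_surjective y
  have hy' : ∀ m, Ideal.Quotient.mk I (a ^ n) =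
      Ideal.Quotient.mk I (a ^ (n + m) * b ^ m) := by
    intro m
    induction m with
    | zero => simp
    | succ m ih =>
      rw [ih]
      simp only [smul_eq_mul, mul_one] at hy
      simp only [map_mul, map_pow]
      calc _ = Ideal.Quotient.mk I a ^ n * Ideal.Quotient.mk I a ^ m *
            Ideal.Quotient.mk I b ^ m := by ring
        _ = _ := by rw [← hy, Nat.succ_eq_add_one]; ring
  have hI : ∀ u v : C, Ideal.Quotient.mk I u = Ideal.Quotient.mk I v → u - v ∈ I :=
    fun u v h => Ideal.Quotient.eq.1 h
  set e₀ : C := a ^ (n + 1) * b ^ (n + 1) with he₀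
  have hmul : Ideal.Quotient.mk I (a ^ (n + 1) * e₀) = Ideal.Quotient.mk I (a ^ (n + 1)) := by
    have h1 := hy' (n + 1)
    calc _ = Ideal.Quotient.mk I a *
          Ideal.Quotient.mk I (a ^ (n + (n + 1)) * b ^ (n + 1)) := by
            rw [he₀, ← map_mul]; congr 1; ring
      _ = _ := by rw [← h1, ← map_mul]; congr 1; ring
  have hidem : e₀ * e₀ - e₀ ∈ I := by
    refine hI _ _ ?_
    calc _ = Ideal.Quotient.mk I (a ^ (n + 1) * e₀) * Ideal.Quotient.mk I (b ^ (n + 1)) := by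
            rw [← map_mul]; congr 1; rw [he₀]; ring
      _ = _ := by rw [hmul, ← map_mul]
  have he₁ : e₀ ∈ M₀ := by
    rw [he₀, pow_succ' a]
    exact Ideal.mul_mem_right _ _ (Ideal.mul_mem_right _ _ ha₁)
  have he₂ : e₀ ∉ M₂ := by
    intro h
    have h1 : a ^ (n + 1) ∈ M₂ := by
      have h2 := hjac M₂ hM₂ (hI _ _ hmul)
      have h3 := M₂.sub_mem (M₂.mul_mem_left (a ^ (n + 1)) h) h2
      rwa [sub_sub_cancel] at h3
    exact ha₂ (hM₂.isPrime.mem_of_pow_mem _ h1)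
  have hunit : IsUnit (Ideal.Quotient.mk I (2 * e₀ - 1)) := by
    refine IsUnit.of_mul_eq_one (Ideal.Quotient.mk I (2 * e₀ - 1)) ?_
    rw [← map_mul, ← map_one (Ideal.Quotient.mk I), Ideal.Quotient.eq]
    have : (2 * e₀ - 1) * (2 * e₀ - 1) - 1 = 4 * (e₀ * e₀ - e₀) := by ring
    rw [this]
    exact I.mul_mem_left _ hidem
  -- Hensel's lemma for `X ^ 2 - X`
  obtain ⟨e, he, hee⟩ := HenselianRing.is_henselian (I := I)
    (Polynomial.X ^ 2 - Polynomial.X : Polynomial C)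
    (by
      have : (Polynomial.X ^ 2 - Polynomial.X : Polynomial C) =
        Polynomial.X * (Polynomial.X - Polynomial.C 1) := by
          rw [Polynomial.C_1]; ring
      rw [this]
      exact Polynomial.monic_X.mul (Polynomial.monic_X_sub_C 1)) e₀
    (by simpa [sq] using hidem)
    (by simpa [one_add_one_eq_two] using hunit)
  have he' : e * (e - 1) = 0 := by
    have : e ^ 2 - e = 0 := by simpa using he
    rw [← this]; ring
  rcases mul_eq_zero.1 he' with h | h
  · rw [h, zero_sub, neg_mem_iff] at hee
    exact he₂ (hjac M₂ hM₂ hee)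
  · rw [sub_eq_zero.1 h] at hee
    have := M₀.add_mem (hjac M₀ hM₀ hee) he₁
    rw [sub_add_cancel] at this
    exact hM₀.ne_top ((Ideal.eq_top_iff_one _).2 this)

/-- A Dedekind domain that is finite over `k⟦X⟧`, with `k` algebraically closed, is a complete
discrete valuation ring with residue field `k`, hence a power series ring. -/
theorem PowerSeries.nonempty_algEquiv_of_finite {k C : Type*} [Field k] [IsAlgClosed k]
    [CommRing C] [IsDedekindDomain C] [Algebra k C] [Algebra (PowerSeries k) C]
    [IsScalarTower k (PowerSeries k) C] [Module.Finite (PowerSeries k) C]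
    (hinj : Function.Injective (algebraMap (PowerSeries k) C)) :
    Nonempty (PowerSeries k ≃ₐ[k] C) := by
  set x : C := algebraMap (PowerSeries k) C PowerSeries.X with hx
  have hx0 : x ≠ 0 := by
    rw [hx, Ne, map_eq_zero_iff _ hinj]; exact PowerSeries.X_ne_zero
  set I₀ : Ideal (PowerSeries k) := Ideal.span {PowerSeries.X} with hI₀
  have hI₀max : I₀ = maximalIdeal (PowerSeries k) := PowerSeries.maximalIdeal_eq_span_X.symm
  have hI : I₀.map (algebraMap (PowerSeries k) C) = Ideal.span {x} := by
    rw [hI₀, Ideal.map_span, Set.image_singleton]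
  have hcomp : IsAdicComplete (Ideal.span {x}) C := by
    rw [← hI, IsAdicComplete.map_algebraMap_iff]
    have h1 : IsPrecomplete I₀ C := IsPrecomplete.of_finite I₀
    have h2 : IsHausdorff I₀ C := by rw [hI₀max]; infer_instance
    exact { toIsHausdorff := h2, toIsPrecomplete := h1 }
  have hxM : ∀ M : Ideal C, M.IsMaximal → x ∈ M := fun M hM =>
    ((IsAdicComplete.le_jacobson_bot _).trans (sInf_le ⟨bot_le, hM⟩) :
      Ideal.span {x} ≤ M) (Ideal.mem_span_singleton_self x)
  have hart : IsArtinianRing (C ⧸ Ideal.span {x}) := by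
    have h1 := isFiniteLength_quotient_span_singleton (R := C) (mem_nonZeroDivisors_of_ne_zero hx0)
    have h2 := (isFiniteLength_iff_isNoetherian_isArtinian.1 h1).2
    exact isArtinian_of_tower C h2
  have hloc : IsLocalRing C :=
    IsLocalRing.of_isAdicComplete_of_isArtinianRing_quotient (Ideal.span {x})
  have hxm : x ∈ maximalIdeal C := hxM _ (maximalIdeal.isMaximal C)
  have hnf : ¬ IsField C := by
    intro hf
    have := (isField_iff_maximalIdeal_eq.1 hf)
    rw [this] at hxm
    exact hx0 (by simpa using hxm)
  have hdvr : IsDiscreteValuationRing C :=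
    ((IsDiscreteValuationRing.TFAE C hnf).out 0 2).2 ‹IsDedekindDomain C›
  -- the power series ring maps to `C` by `X ↦ t`, as a power of `t` is divisible by `x`
  obtain ⟨t, ht⟩ := IsDiscreteValuationRing.exists_irreducible C
  obtain ⟨e, u, hu⟩ := IsDiscreteValuationRing.eq_unit_mul_pow_irreducible hx0 ht
  have hte : t ^ e ∈ Ideal.span {x} :=
    Ideal.mem_span_singleton.2 ⟨((u⁻¹ : Cˣ) : C), by rw [hu, mul_comm, Units.inv_mul_cancel_left]⟩
  obtain ⟨f, hf⟩ := exists_algHom_powerSeries_X_eq (k := k) (Ideal.span {x}) t e hte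
  have hmax : maximalIdeal C = Ideal.span {t} := ht.maximalIdeal_eq
  -- the residue field is integral over `k`, because `x` maps to `0`
  have hres : Function.Surjective (algebraMap k (C ⧸ maximalIdeal C)) := by
    have hint : (algebraMap k (C ⧸ maximalIdeal C)).IsIntegral := by
      have h1 : (algebraMap k (C ⧸ maximalIdeal C)).comp (PowerSeries.constantCoeff (R := k)) =
          (Ideal.Quotient.mk (maximalIdeal C)).comp (algebraMap (PowerSeries k) C) := by
        ext g
        have h2 := PowerSeries.eq_X_mul_shift_add_const g
        conv_rhs => rw [h2]
        rw [RingHom.comp_apply, RingHom.comp_apply, map_add, map_add, map_mul, map_mul, ← hx,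
          Ideal.Quotient.eq_zero_iff_mem.2 hxm, zero_mul, zero_add]
        rw [← PowerSeries.algebraMap_eq, ← IsScalarTower.algebraMap_apply k (PowerSeries k) C]
        rfl
      have h3 : (algebraMap (PowerSeries k) C).IsIntegral := Algebra.IsIntegral.isIntegral
      refine RingHom.IsIntegral.tower_top (PowerSeries.constantCoeff (R := k)) _ ?_
      rw [h1]
      exact h3.trans _ _ (RingHom.isIntegral_of_surjective _ Ideal.Quotient.mk_surjective)
    have : Algebra.IsIntegral k (C ⧸ maximalIdeal C) := ⟨hint⟩
    exact (IsAlgClosed.algebraMap_bijective_of_isIntegral (k := k)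
      (K := C ⧸ maximalIdeal C)).2
  have hmap : I₀.map (f : PowerSeries k →+* C) = maximalIdeal C := by
    rw [hmax, hI₀, Ideal.map_span, Set.image_singleton, RingHom.coe_coe, hf]
  refine ⟨AlgEquiv.ofBijective f ⟨?_, ?_⟩⟩
  · exact PowerSeries.injective_of_map_X_ne_zero (f : PowerSeries k →+* C)
      (by rw [RingHom.coe_coe, hf]; exact ht.ne_zero)
  · have : IsHausdorff (I₀.map (f : PowerSeries k →+* C)) C := by
      rw [hmap]; infer_instance
    refine surjective_of_mk_map_comp_surjective (I := I₀) (f : PowerSeries k →+* C) ?_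
    rw [hmap]
    intro c
    obtain ⟨r, rfl⟩ := hres c
    refine ⟨algebraMap k _ r, ?_⟩
    rw [RingHom.comp_apply, RingHom.coe_coe, f.commutes]
    rfl

/-- A one-dimensional domain that is finite over `k⟦X⟧` embeds into its normalization, which is
a power series ring, with nonzero conductor. -/
theorem exists_branch_parametrization {k B : Type*} [Field k] [IsAlgClosed k] [CharZero k]
    [CommRing B] [IsDomain B] [Algebra k B] [Algebra (PowerSeries k) B]
    [IsScalarTower k (PowerSeries k) B] [Module.Finite (PowerSeries k) B]
    (hinj : Function.Injective (algebraMap (PowerSeries k) B)) :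
    ∃ ψ : B →ₐ[k] PowerSeries k, Function.Injective ψ ∧ (ψ : B →+* PowerSeries k).IsIntegral ∧
      ∃ f : B, f ≠ 0 ∧ ∀ g : PowerSeries k, ∃ b : B, ψ b = ψ f * g := by
  let R := PowerSeries k
  let K := FractionRing R
  let L := FractionRing B
  have : FaithfulSMul R B := (faithfulSMul_iff_algebraMap_injective R B).2 hinj
  let _ : Algebra K L := FractionRing.liftAlgebra R L
  have : IsScalarTower R K L := FractionRing.isScalarTower_liftAlgebra R L
  have : IsLocalization (Algebra.algebraMapSubmonoid B (nonZeroDivisors R)) L := by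
    infer_instance
  have : FiniteDimensional K L := by
    exact Module.Finite.of_isLocalization R B (nonZeroDivisors R)
  let C := integralClosure R L
  have : CharZero R := charZero_of_injective_ringHom (PowerSeries.C_injective (R := k))
  have : CharZero K := charZero_of_injective_algebraMap (IsFractionRing.injective R K)
  have : Module.Finite R C := IsIntegralClosure.finite R K L C
  have : IsDedekindDomain C := integralClosure.isDedekindDomain R K L
  have hRC : Function.Injective (algebraMap R C) := by
    exact FaithfulSMul.algebraMap_injective _ _
  obtain ⟨E⟩ := PowerSeries.nonempty_algEquiv_of_finite (k := k) hRC
  have hBC : ∀ b : B, algebraMap B L b ∈ C := fun b =>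
    (Algebra.IsIntegral.isIntegral (R := R) b).map (IsScalarTower.toAlgHom R B L)
  let j : B →ₐ[k] C := ((IsScalarTower.toAlgHom R B L).codRestrict C hBC).restrictScalars k
  have hj : ∀ b, ((j b : C) : L) = algebraMap B L b := fun b => rfl
  refine ⟨(E.symm : C →ₐ[k] PowerSeries k).comp j, ?_, ?_, ?_⟩
  · refine E.symm.injective.comp fun b₁ b₂ h => ?_
    exact IsFractionRing.injective B L (by rw [← hj, ← hj]; exact congrArg _ h)
  · have h1 : ((j : B →+* C).comp (algebraMap R B)).IsIntegral := by
      have h2 : (algebraMap R C).IsIntegral := Algebra.IsIntegral.isIntegral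
      exact h2
    exact (RingHom.IsIntegral.tower_top _ _ h1).trans _ _
      (RingHom.isIntegral_of_surjective ((E.symm : C →ₐ[k] PowerSeries k) : C →+* PowerSeries k)
        E.symm.surjective)
  -- a common denominator of generators of the finite module `C` is in the conductor
  · obtain ⟨s, hs⟩ := Module.Finite.fg_top (R := R) (M := C)
    obtain ⟨f, hf⟩ := IsLocalization.exist_integer_multiples (nonZeroDivisors B)
      s (fun c : C => (c : L))
    have hfC : ∀ c : C, ∃ b : B, j b = j f * c := by
      intro c
      have hc : c ∈ Submodule.span R (s : Set C) := hs ▸ trivial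
      induction hc using Submodule.span_induction with
      | mem c hc =>
        obtain ⟨b, hb⟩ := hf c hc
        refine ⟨b, Subtype.ext ?_⟩
        rw [hj, hb, Algebra.smul_def]
        rfl
      | zero => exact ⟨0, by simp⟩
      | add c₁ c₂ _ _ h₁ h₂ =>
        obtain ⟨b₁, h₁⟩ := h₁
        obtain ⟨b₂, h₂⟩ := h₂
        exact ⟨b₁ + b₂, by rw [map_add, h₁, h₂, mul_add]⟩
      | smul r c _ h =>
        obtain ⟨b, h⟩ := h
        refine ⟨r • b, ?_⟩
        have : j (r • b) = r • j b := map_smul ((IsScalarTower.toAlgHom R B L).codRestrict C hBC) r b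
        rw [this, h, mul_smul_comm]
    refine ⟨f, nonZeroDivisors.ne_zero f.2, fun g => ?_⟩
    obtain ⟨b, hb⟩ := hfC (E g)
    refine ⟨b, ?_⟩
    change E.symm (j b) = E.symm (j f) * g
    rw [hb, map_mul, E.symm_apply_apply]

/-! ### Parametrization of an algebroid curve -/

/-- As modules over any intermediate algebra `R` between `k` and `A`, the quotients of `A` by powers of
its maximal ideal are finite. -/
theorem exists_fg_submodule_sub_mem_pow {k A R : Type*} [Field k] [CommRing A] [IsLocalRing A]
    [IsNoetherianRing A] [Algebra k A] [CommRing R] [Algebra k R] [Algebra R A]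
    [IsScalarTower k R A] (hres : ∀ a : A, ∃ c : k, a - algebraMap k A c ∈ maximalIdeal A)
    (n : ℕ) : ∃ N : Submodule R A, N.FG ∧ ∀ a : A, ∃ b ∈ N, a - b ∈ maximalIdeal A ^ n := by
  induction n with
  | zero => exact ⟨⊥, Submodule.fg_bot, fun a => ⟨0, by simp⟩⟩
  | succ n ih =>
    obtain ⟨N, hN, h⟩ := ih
    obtain ⟨s, hs⟩ := (isNoetherianRing_iff_ideal_fg A).1 ‹_› (maximalIdeal A)
    refine ⟨Submodule.span R {1} ⊔ ⨆ i ∈ s, N.map (LinearMap.mulLeft R i), ?_, fun a => ?_⟩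
    · refine (Submodule.fg_span_singleton _).sup (Submodule.fg_biSup _ _ fun i _ => hN.map _)
    · obtain ⟨c, hc⟩ := hres a
      rw [← hs] at hc
      obtain ⟨g, -, hg⟩ := Submodule.mem_span_finset.1 hc
      choose b hb hb' using fun i : A => h (g i)
      refine ⟨algebraMap k A c + ∑ i ∈ s, i * b i, ?_, ?_⟩
      · refine Submodule.add_mem_sup ?_ (Submodule.sum_mem _ fun i hi => ?_)
        · rw [IsScalarTower.algebraMap_apply k R A, Algebra.algebraMap_eq_smul_one]
          exact Submodule.smul_mem _ _ (Submodule.mem_span_singleton_self 1)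
        · exact Submodule.mem_iSup_of_mem i (Submodule.mem_iSup_of_mem hi
            ⟨b i, hb i, rfl⟩)
      · rw [← sub_sub, ← hg, ← Finset.sum_sub_distrib]
        refine Submodule.sum_mem _ fun i hi => ?_
        rw [smul_eq_mul, mul_comm, ← mul_sub, pow_succ']
        exact Ideal.mul_mem_mul (hs ▸ Ideal.subset_span hi) (hb' i)

theorem eq_zero_of_forall_mem_minimalPrimes {A : Type*} [CommRing A] [IsReduced A] {a : A}
    (h : ∀ p ∈ minimalPrimes A, a ∈ p) : a = 0 := by
  have h1 : a ∈ nilradical A := by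
    rw [nilradical, ← Ideal.sInf_minimalPrimes, Submodule.mem_sInf]
    exact h
  simpa [nilradical_eq_zero] using h1

namespace IsReducedAlgebroidCurve

variable {k A : Type*} [Field k] [CommRing A] [IsLocalRing A] [Algebra k A]

theorem exists_sub_algebraMap_mem (hA : IsReducedAlgebroidCurve k A) (a : A) :
    ∃ c : k, a - algebraMap k A c ∈ maximalIdeal A := by
  obtain ⟨c, hc⟩ := hA.residue.2 (IsLocalRing.residue A a)
  refine ⟨c, ?_⟩
  rw [← IsLocalRing.residue_eq_zero_iff, map_sub, sub_eq_zero, ← hc]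
  rfl

theorem not_maximalIdeal_le (hA : IsReducedAlgebroidCurve k A) {p : Ideal A}
    (hp : p ∈ minimalPrimes A) : ¬ maximalIdeal A ≤ p := by
  intro h
  have h1 : p = maximalIdeal A := le_antisymm (le_maximalIdeal hp.1.1.ne_top) h
  have h2 := IsLocalRing.maximalIdeal_height_eq_ringKrullDim (R := A)
  rw [hA.dim_one] at h2
  have : (maximalIdeal A).height = 0 := by
    rw [← h1]
    have := hp.1.1
    exact Ideal.height_eq_zero_iff.2 hp
  rw [this] at h2
  exact absurd h2 (by norm_num)

theorem finite_minimalPrimes (hA : IsReducedAlgebroidCurve k A) : Finite (minimalPrimes A) := by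
  have := hA.noetherian
  exact (minimalPrimes.finite_of_isNoetherianRing A).to_subtype

/-- A parameter: an element of the maximal ideal that does not vanish on any branch. -/
theorem exists_parameter (hA : IsReducedAlgebroidCurve k A) :
    ∃ x ∈ maximalIdeal A, ∀ p ∈ minimalPrimes A, x ∉ p := by
  have := hA.noetherian
  have hfin := minimalPrimes.finite_of_isNoetherianRing A
  by_contra! hcon
  have h : (maximalIdeal A : Set A) ⊆ ⋃ p ∈ (hfin.toFinset : Set (Ideal A)), (p : Set A) := by
    intro x hx
    obtain ⟨p, hp, hxp⟩ := hcon x hx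
    simp only [Set.mem_iUnion]
    exact ⟨p, by simpa using hp, hxp⟩
  rw [Ideal.subset_union_prime (f := fun p : Ideal A => p) ⊥ ⊥ fun p hp _ _ => by
    exact (hfin.mem_toFinset.1 hp).1.1] at h
  obtain ⟨p, hp, h⟩ := h
  exact hA.not_maximalIdeal_le (hfin.mem_toFinset.1 hp) h

/-- Noether normalization: the curve is finite over the power series ring of any parameter. -/
theorem finite_powerSeries (hA : IsReducedAlgebroidCurve k A) [Algebra (PowerSeries k) A]
    [IsScalarTower k (PowerSeries k) A]
    (hxm : algebraMap (PowerSeries k) A PowerSeries.X ∈ maximalIdeal A)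
    (hx : ∀ p ∈ minimalPrimes A, algebraMap (PowerSeries k) A PowerSeries.X ∉ p) :
    Module.Finite (PowerSeries k) A := by
  have := hA.noetherian
  have := hA.reduced
  set x := algebraMap (PowerSeries k) A PowerSeries.X
  have hdim : Ring.KrullDimLE 1 A := by
    rw [Ring.krullDimLE_iff, hA.dim_one]
    rfl
  have hx0 : x ∈ nonZeroDivisors A := by
    rw [mem_nonZeroDivisors_iff_right]
    intro y hy
    refine eq_zero_of_forall_mem_minimalPrimes fun p hp => ?_
    exact (hp.1.1.mem_or_mem (hy ▸ p.zero_mem : y * x ∈ p)).resolve_right (hx p hp)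
  have hart : IsArtinianRing (A ⧸ Ideal.span {x}) := isArtinian_of_tower A
    (isFiniteLength_iff_isNoetherian_isArtinian.1 (isFiniteLength_quotient_span_singleton A hx0)).2
  obtain ⟨n, hn⟩ := exists_maximalIdeal_pow_le_of_isArtinianRing_quotient (Ideal.span {x})
  obtain ⟨N, hN, h⟩ := exists_fg_submodule_sub_mem_pow (R := PowerSeries k)
    hA.exists_sub_algebraMap_mem n
  set I₀ : Ideal (PowerSeries k) := Ideal.span {PowerSeries.X} with hI₀
  have hI : I₀.map (algebraMap (PowerSeries k) A) = Ideal.span {x} := by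
    rw [hI₀, Ideal.map_span, Set.image_singleton]
  have hH : IsHausdorff I₀ A := by
    rw [← IsHausdorff.map_algebraMap_iff (S := A), hI]
    refine IsHausdorff.of_isLocalRing _ _ fun h => ?_
    have : Ideal.span {x} ≤ maximalIdeal A := (Ideal.span_singleton_le_iff_mem _).2 hxm
    exact (maximalIdeal.isMaximal A).ne_top (top_le_iff.1 (h ▸ this))
  refine Module.Finite.of_fg_top ?_
  rw [← Submodule.eq_top_of_sup_smul_eq_top I₀ N hN ?_]
  · exact hN
  · rw [eq_top_iff]
    intro a _
    obtain ⟨b, hb, hab⟩ := h a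
    rw [← add_sub_cancel b a]
    refine Submodule.add_mem_sup hb ?_
    rw [Ideal.smul_top_eq_map, hI]
    exact hn hab

/-- The parametrization of the branch with ideal `p`, by the normalization of `A ⧸ p`. The element
`f` is in the conductor. -/
theorem exists_branch (hA : IsReducedAlgebroidCurve k A) [IsAlgClosed k] [CharZero k] :
    ∀ p ∈ minimalPrimes A, ∃ ψ : A →ₐ[k] PowerSeries k, (∀ a, ψ a = 0 ↔ a ∈ p) ∧
      (ψ : A →+* PowerSeries k).IsIntegral ∧
      ∃ f : A, ψ f ≠ 0 ∧ ∀ g : PowerSeries k, ∃ b : A, ψ b = ψ f * g := by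
  obtain ⟨x, hxm, hx⟩ := hA.exists_parameter
  have := hA.complete
  obtain ⟨F, hF⟩ := exists_algHom_powerSeries_X_eq (k := k) (maximalIdeal A) x 1 (by simpa)
  let _ : Algebra (PowerSeries k) A := (F : PowerSeries k →+* A).toAlgebra
  have hFa : algebraMap (PowerSeries k) A PowerSeries.X = x := hF
  have : IsScalarTower k (PowerSeries k) A := IsScalarTower.of_algHom F
  have := hA.finite_powerSeries (hFa ▸ hxm) (hFa ▸ hx)
  intro p hp
  have := hp.1.1
  have hinj : Function.Injective (algebraMap (PowerSeries k) (A ⧸ p)) := by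
    refine PowerSeries.injective_of_map_X_ne_zero _ ?_
    rw [IsScalarTower.algebraMap_apply _ A, hFa, Ideal.Quotient.algebraMap_eq, Ne,
      Ideal.Quotient.eq_zero_iff_mem]
    exact hx p hp
  obtain ⟨ψ, hψ, hint, f, hf0, hf⟩ := exists_branch_parametrization (k := k) hinj
  obtain ⟨f, rfl⟩ := Ideal.Quotient.mk_surjective f
  refine ⟨ψ.comp (Ideal.Quotient.mkₐ k p), fun a => ?_, ?_, f, ?_, fun g => ?_⟩
  · rw [AlgHom.comp_apply, map_eq_zero_iff _ hψ]
    exact Ideal.Quotient.eq_zero_iff_mem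
  · exact (RingHom.isIntegral_of_surjective _ Ideal.Quotient.mk_surjective).trans _ _ hint
  · rw [AlgHom.comp_apply, Ne, map_eq_zero_iff _ hψ]
    exact hf0
  · obtain ⟨b, hb⟩ := hf g
    obtain ⟨b, rfl⟩ := Ideal.Quotient.mk_surjective b
    exact ⟨b, hb⟩

/-- An element vanishing on all branches but one. -/
theorem exists_mem_of_ne (hA : IsReducedAlgebroidCurve k A) (p : minimalPrimes A) :
    ∃ e : A, e ∉ (p : Ideal A) ∧ ∀ q : minimalPrimes A, q ≠ p → e ∈ (q : Ideal A) := by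
  classical
  have := hA.finite_minimalPrimes
  cases nonempty_fintype (minimalPrimes A)
  have hp := p.2.1.1
  have h : ∀ q : minimalPrimes A, ∃ a : A, a ∉ (p : Ideal A) ∧ (q ≠ p → a ∈ (q : Ideal A)) := by
    intro q
    by_cases hq : q = p
    · exact ⟨1, (Ideal.ne_top_iff_one _).1 hp.ne_top, fun h => (h hq).elim⟩
    · by_contra! hcon
      have hle : (q : Ideal A) ≤ p := fun a ha => by
        by_contra hap
        exact (hcon a hap).2 ha
      exact hq (Subtype.ext (le_antisymm hle (p.2.2 q.2.1 hle)))
  choose a ha ha' using h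
  refine ⟨∏ q, a q, ?_, fun q hq => ?_⟩
  · rw [hp.prod_mem_iff]
    rintro ⟨q, -, hq⟩
    exact ha q hq
  · exact Ideal.mem_of_dvd _ (Finset.dvd_prod_of_mem a (Finset.mem_univ q)) (ha' q hq)

end IsReducedAlgebroidCurve

theorem RingHom.isIntegral_pi {ι A B : Type*} [_root_.Finite ι] [CommRing A] [CommRing B]
    (f : A →+* (ι → B)) (h : ∀ i, ((Pi.evalRingHom (fun _ : ι => B) i).comp f).IsIntegral) :
    f.IsIntegral := by
  cases nonempty_fintype ι
  intro y
  choose P hP hP' using fun i => h i (y i)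
  refine ⟨∏ i, P i, Polynomial.monic_prod_of_monic _ _ fun i _ => hP i, ?_⟩
  funext i
  have := Polynomial.hom_eval₂ (∏ i, P i) f (Pi.evalRingHom (fun _ : ι => B) i) y
  refine this.trans ?_
  rw [Polynomial.eval₂_finsetProd]
  exact Finset.prod_eq_zero (Finset.mem_univ i) (hP' i)

/-- A parametrization of a curve `A`: an embedding of `A` into a product of power series rings,
one for each branch. The image contains a power of the parameter times the whole product, and the
product is integral over the image. -/
structure CurveParametrization (k A : Type*) [Field k] [CommRing A] [Algebra k A] where
  toAlgHom : A →ₐ[k] (minimalPrimes A → PowerSeries k)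
  apply_eq_zero_iff : ∀ (a : A) (p : minimalPrimes A), toAlgHom a p = 0 ↔ a ∈ (p : Ideal A)
  isIntegral : (toAlgHom : A →+* (minimalPrimes A → PowerSeries k)).IsIntegral
  exists_conductor : ∃ N : ℕ, 0 < N ∧ ∀ g : minimalPrimes A → PowerSeries k,
    ∃ a : A, ∀ p, toAlgHom a p = PowerSeries.X ^ N * g p

/-- The conductors of the branches, multiplied by elements that vanish on the other branches, add
up to an element of the conductor of the curve. -/
theorem IsReducedAlgebroidCurve.nonempty_curveParametrization {k A : Type*} [Field k] [CommRing A]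
    [IsLocalRing A] [Algebra k A] [IsAlgClosed k] [CharZero k]
    (hA : IsReducedAlgebroidCurve k A) : Nonempty (CurveParametrization k A) := by
  classical
  have := hA.finite_minimalPrimes
  cases nonempty_fintype (minimalPrimes A)
  choose ψ hψ hint f hf0 hf using fun p : minimalPrimes A => hA.exists_branch p.1 p.2
  choose e he he' using hA.exists_mem_of_ne
  refine ⟨⟨AlgHom.pi ψ, fun a p => hψ p a, RingHom.isIntegral_pi _ hint, ?_⟩⟩
  have hu : ∀ p, ψ p (e p) * ψ p (f p) ≠ 0 := fun p =>
    mul_ne_zero (fun h => he p ((hψ p _).1 h)) (hf0 p)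
  have hdvd : ∀ p, ∃ n : ℕ, ψ p (e p) * ψ p (f p) ∣ PowerSeries.X ^ n := by
    intro p
    obtain ⟨n, v, hv⟩ := IsDiscreteValuationRing.eq_unit_mul_pow_irreducible (hu p)
      PowerSeries.X_prime.irreducible
    exact ⟨n, by rw [hv]; exact v.isUnit.mul_left_dvd.2 dvd_rfl⟩
  choose n hn using hdvd
  refine ⟨1 + ∑ p, n p, by omega, fun g => ?_⟩
  have hN : ∀ p, ∃ a : A, ψ p (e p) * ψ p a = PowerSeries.X ^ (1 + ∑ p, n p) * g p := by
    intro p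
    have hle : n p ≤ 1 + ∑ p, n p :=
      (Finset.single_le_sum (fun _ _ => Nat.zero_le _) (Finset.mem_univ p)).trans (by omega)
    obtain ⟨c, hc⟩ := (hn p).trans (pow_dvd_pow PowerSeries.X hle)
    obtain ⟨b, hb⟩ := hf p (c * g p)
    exact ⟨b, by rw [hb, hc]; ring⟩
  choose a ha using hN
  refine ⟨∑ p, e p * a p, fun q => ?_⟩
  change ψ q _ = _
  rw [map_sum, Finset.sum_eq_single q, map_mul, ha]
  · intro p _ hpq
    rw [map_mul, (hψ q _).2 (he' p q hpq.symm), zero_mul]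
  · simp

/-! ### Coordinates on the normalization -/

namespace CurveParametrization

variable {k A : Type*} [Field k] [CommRing A] [Algebra k A]

theorem ext_of_apply_eq [IsReduced A] (φ : CurveParametrization k A) {a b : A}
    (h : ∀ p, φ.toAlgHom a p = φ.toAlgHom b p) : a = b := by
  rw [← sub_eq_zero]
  refine eq_zero_of_forall_mem_minimalPrimes fun p hp => ?_
  rw [← φ.apply_eq_zero_iff _ ⟨p, hp⟩, map_sub, Pi.sub_apply, h, sub_self]

theorem apply_ne_zero_of_mem_nonZeroDivisors [IsReduced A] (φ : CurveParametrization k A) {b : A}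
    (hb : b ∈ nonZeroDivisors A) (p : minimalPrimes A) : φ.toAlgHom b p ≠ 0 := by
  classical
  intro h
  obtain ⟨N, -, hN⟩ := φ.exists_conductor
  obtain ⟨a, ha⟩ := hN (Pi.single p 1)
  have h1 : a * b = 0 := φ.ext_of_apply_eq fun q => by
    rw [map_mul, Pi.mul_apply, ha, map_zero, Pi.zero_apply]
    by_cases hq : q = p
    · subst hq; rw [h, mul_zero]
    · rw [Pi.single_eq_of_ne hq, mul_zero, zero_mul]
  have h2 := ha p
  rw [(mem_nonZeroDivisors_iff_right.1 hb) a h1, map_zero, Pi.zero_apply, Pi.single_eq_same,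
    mul_one] at h2
  exact pow_ne_zero N PowerSeries.X_ne_zero h2.symm

/-- Every parametrization comes from coordinates on the normalization: the product of the power
series rings is integrally closed, integral over `A`, and has the same total ring of fractions. -/
theorem exists_coordinates [IsReduced A] (φ : CurveParametrization k A) :
    ∃ t : NormalizationCoordinates k A,
      ∀ a, t.toAlgEquiv (algebraMap A (Normalization A) a) = φ.toAlgHom a := by
  obtain ⟨N, -, hN⟩ := φ.exists_conductor
  choose s hs using hN
  let K := FractionRing A
  obtain ⟨w, hw⟩ : ∃ w : A, ∀ p, φ.toAlgHom w p = PowerSeries.X ^ N :=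
    ⟨s 1, fun p => by rw [hs, Pi.one_apply, mul_one]⟩
  have hX : (PowerSeries.X ^ N : PowerSeries k) ≠ 0 := pow_ne_zero N PowerSeries.X_ne_zero
  have hw0 : w ∈ nonZeroDivisors A := by
    rw [mem_nonZeroDivisors_iff_right]
    intro y hy
    refine φ.ext_of_apply_eq fun p => ?_
    have h := congrFun (congrArg φ.toAlgHom hy) p
    rw [map_mul, Pi.mul_apply, hw, map_zero, Pi.zero_apply] at h
    rw [map_zero, Pi.zero_apply]
    exact (mul_eq_zero.1 h).resolve_right hX
  -- the inverse of the parametrization sends `g` to `s g / w`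
  let W : nonZeroDivisors A := ⟨w, hw0⟩
  have hmk : ∀ (g : minimalPrimes A → PowerSeries k) (a b : A) (hb : b ∈ nonZeroDivisors A),
      φ.toAlgHom b * g = φ.toAlgHom a →
      IsLocalization.mk' K (s g) W = IsLocalization.mk' K a ⟨b, hb⟩ := by
    intro g a b hb h
    rw [IsLocalization.mk'_eq_iff_eq]
    congr 1
    refine φ.ext_of_apply_eq fun p => ?_
    have h := congrFun h p
    rw [Pi.mul_apply] at h
    change φ.toAlgHom (b * s g) p = φ.toAlgHom (w * a) p
    rw [map_mul, map_mul, Pi.mul_apply, Pi.mul_apply, hs, hw, ← h]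
    ring
  have hjφ : ∀ a, IsLocalization.mk' K (s (φ.toAlgHom a)) W = algebraMap A K a := by
    intro a
    rw [hmk _ a 1 (one_mem _) (by rw [map_one, one_mul])]
    exact IsLocalization.mk'_one K a
  let j : (minimalPrimes A → PowerSeries k) →+* K :=
    { toFun := fun g => IsLocalization.mk' K (s g) W
      map_one' := by
        have := hjφ 1
        rwa [map_one, map_one] at this
      map_zero' := by
        have := hjφ 0
        rwa [map_zero, map_zero] at this
      map_mul' := fun g h => by
        rw [← IsLocalization.mk'_mul]
        refine hmk _ _ _ (W * W).2 ?_
        funext p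
        change φ.toAlgHom (w * w) p * (g p * h p) = φ.toAlgHom (s g * s h) p
        rw [map_mul, map_mul, Pi.mul_apply, Pi.mul_apply, hs, hs, hw]
        ring
      map_add' := fun g h => by
        have h1 : s (g + h) = s g + s h := φ.ext_of_apply_eq fun p => by
          rw [map_add, Pi.add_apply, hs, hs, hs, Pi.add_apply, mul_add]
        rw [h1, IsLocalization.mk'_eq_mul_mk'_one, map_add, add_mul,
          ← IsLocalization.mk'_eq_mul_mk'_one, ← IsLocalization.mk'_eq_mul_mk'_one] }
  have hj : j.comp (φ.toAlgHom : A →+* (minimalPrimes A → PowerSeries k)) = algebraMap A K :=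
    RingHom.ext hjφ
  have hjint : ∀ g, j g ∈ integralClosure A K := by
    intro g
    obtain ⟨P, hP, hP'⟩ := φ.isIntegral g
    refine ⟨P, hP, ?_⟩
    rw [← hj, ← Polynomial.hom_eval₂, hP', map_zero]
  let J : (minimalPrimes A → PowerSeries k) →ₐ[k] Normalization A :=
    { j.codRestrict (integralClosure A K).toSubring hjint with
      commutes' := fun c => by
        refine Subtype.ext ?_
        have := hjφ (algebraMap k A c)
        rw [AlgHom.commutes] at this
        exact this }
  have hJ : ∀ g, ((J g : Normalization A) : K) = j g := fun g => rfl
  have hbij : Function.Bijective J := by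
    constructor
    · intro g h hgh
      have h1 : j g = j h := by rw [← hJ, ← hJ, hgh]
      have h2 : s g = s h := by
        refine IsFractionRing.injective A K ?_
        have := congrArg (fun z => algebraMap A K w * z) h1
        simpa [j, W, IsLocalization.mk'_spec'_mk] using this
      funext p
      have h3 := hs g p
      rw [h2, hs] at h3
      exact (mul_left_cancel₀ hX h3).symm
    · rintro ⟨z, hz⟩
      obtain ⟨a, b, rfl⟩ := IsLocalization.exists_mk'_eq (nonZeroDivisors A) z
      -- on each branch, `a / b` is integral over the integrally closed power series ring
      have hdvd : ∀ p, ∃ g : PowerSeries k, φ.toAlgHom b p * g = φ.toAlgHom a p := by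
        intro p
        let F := FractionRing (PowerSeries k)
        let ev : A →+* PowerSeries k :=
          (Pi.evalRingHom (fun _ => PowerSeries k) p).comp (φ.toAlgHom : A →+* _)
        have hev : ∀ y : nonZeroDivisors A, IsUnit (((algebraMap (PowerSeries k) F).comp ev) y) :=
          fun y => by
            rw [isUnit_iff_ne_zero, RingHom.comp_apply, Ne,
              map_eq_zero_iff _ (IsFractionRing.injective (PowerSeries k) F)]
            exact φ.apply_ne_zero_of_mem_nonZeroDivisors y.2 p
        let l : K →+* F := IsLocalization.lift hev
        have hl : l.comp (algebraMap A K) = (algebraMap (PowerSeries k) F).comp ev :=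
          IsLocalization.lift_comp hev
        obtain ⟨P, hP, hP'⟩ := hz
        have hint : IsIntegral (PowerSeries k) (l (IsLocalization.mk' K a b)) := by
          refine ⟨P.map ev, hP.map ev, ?_⟩
          rw [Polynomial.eval₂_map, ← hl, ← Polynomial.hom_eval₂, hP', map_zero]
        obtain ⟨g, hg⟩ := IsIntegrallyClosed.isIntegral_iff.1 hint
        refine ⟨g, IsFractionRing.injective (PowerSeries k) F ?_⟩
        have h1 := congrArg l (IsLocalization.mk'_spec' K a b)
        rw [map_mul, ← hg] at h1
        rw [map_mul]
        have h2 : ∀ y, l (algebraMap A K y) = algebraMap (PowerSeries k) F (φ.toAlgHom y p) :=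
          fun y => RingHom.congr_fun hl y
        rwa [h2, h2] at h1
      choose g hg using hdvd
      refine ⟨g, Subtype.ext ?_⟩
      exact hmk g a b b.2 (funext hg)
  let E := AlgEquiv.ofBijective J hbij
  have hE : ∀ a, E.symm (algebraMap A (Normalization A) a) = φ.toAlgHom a := by
    intro a
    rw [AlgEquiv.symm_apply_eq]
    exact Subtype.ext (hjφ a).symm
  refine ⟨⟨E.symm, fun a p => ?_⟩, hE⟩
  rw [hE, φ.apply_eq_zero_iff]

end CurveParametrization

/-- A derivation has at most one lift to the normalization. -/
theorem IsLiftToNormalization.unique {k A : Type*} [Field k] [CommRing A] [Algebra k A]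
    {χ : Derivation k A A} {D D' : Derivation k (Normalization A) (Normalization A)}
    (hD : IsLiftToNormalization χ D) (hD' : IsLiftToNormalization χ D') : D' = D := by
  ext z
  obtain ⟨a, b, hab⟩ := IsLocalization.exists_mk'_eq (nonZeroDivisors A) (z : FractionRing A)
  have hz : algebraMap A (Normalization A) b * z = algebraMap A (Normalization A) a := by
    refine Subtype.ext ?_
    have := IsLocalization.mk'_spec' (FractionRing A) a b
    rw [hab] at this
    exact this
  have h : algebraMap A (Normalization A) b * (D' z - D z) = 0 := by
    have h1 := congrArg D hz
    have h2 := congrArg D' hz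
    rw [Derivation.leibniz, hD, hD, smul_eq_mul, smul_eq_mul] at h1
    rw [Derivation.leibniz, hD', hD', smul_eq_mul, smul_eq_mul] at h2
    linear_combination h2 - h1
  have h' := congrArg Subtype.val h
  have hu := IsLocalization.map_units (FractionRing A) b
  have h3 : ((D' z - D z : Normalization A) : FractionRing A) = 0 :=
    (hu.mul_right_eq_zero).1 h'
  have h4 : D' z - D z = 0 := Subtype.ext h3
  rw [sub_eq_zero.1 h4]

/-! ### Linearization of a vector field on the formal line -/

namespace PowerSeries

variable {k : Type*} [Field k]

theorem X_mul_derivative_X_pow_mul (e : ℕ) (g : PowerSeries k) :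
    X * derivative k (X ^ e * g) = X ^ e * ((e : PowerSeries k) * g + X * derivative k g) := by
  rw [Derivation.leibniz, Derivation.leibniz_pow, derivative_X]
  simp only [smul_eq_mul, nsmul_eq_mul, mul_one]
  cases e with
  | zero => simp
  | succ e => rw [Nat.add_sub_cancel]; ring

theorem exists_eq_sum_add_X_pow_mul (n : ℕ) (g : PowerSeries k) :
    ∃ g' : PowerSeries k, g = ∑ i ∈ Finset.range n, coeff i g • X ^ i + X ^ n * g' := by
  have : X ^ n ∣ g - ∑ i ∈ Finset.range n, coeff i g • (X : PowerSeries k) ^ i := by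
    rw [X_pow_dvd_iff]
    intro m hm
    rw [map_sub, map_sum, Finset.sum_eq_single m]
    · simp
    · intro i _ hi
      rw [map_smul, coeff_X_pow, if_neg hi.symm, smul_zero]
    · intro h
      exact absurd (Finset.mem_range.2 hm) h
  obtain ⟨g', hg'⟩ := this
  exact ⟨g', by rw [← hg']; ring⟩

theorem eq_zero_of_forall_X_pow_mul_dvd {g : PowerSeries k} {N : ℕ} (hN : 0 < N)
    (h : ∀ r, X ^ (N * r) ∣ g) : g = 0 := by
  ext n
  have h1 : X ^ (n + 1) ∣ g := (pow_dvd_pow _ (Nat.le_mul_of_pos_left (n + 1) hN)).trans (h (n + 1))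
  rw [X_pow_dvd_iff.1 h1 n (Nat.lt_succ_self n), map_zero]

variable [CharZero k]

/-- The solution of `v' = q * v` with `v(0) = 1`, the exponential of a primitive of `q`. -/
theorem exists_derivative_eq_mul (q : PowerSeries k) :
    ∃ v : PowerSeries k, constantCoeff v = 1 ∧ derivative k v = q * v := by
  let F : PowerSeries k := mk fun n => coeff (n - 1) q / n
  have hF0 : constantCoeff F = 0 := by
    rw [← coeff_zero_eq_constantCoeff_apply, coeff_mk, Nat.cast_zero, div_zero]
  have hF : derivative k F = q := by
    ext n
    rw [coeff_derivative, coeff_mk, Nat.add_sub_cancel]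
    have : (n : k) + 1 ≠ 0 := Nat.cast_add_one_ne_zero n
    push_cast
    field_simp
  have hs : HasSubst F := HasSubst.of_constantCoeff_zero' hF0
  refine ⟨(exp k).subst F, ?_, ?_⟩
  · have h1 : MvPowerSeries.constantCoeff (subst F (exp k - 1)) = 0 :=
      constantCoeff_subst_eq_zero hF0 _ (by rw [map_sub, constantCoeff_exp, map_one, sub_self])
    have h2 : subst F (1 : PowerSeries k) = 1 := by rw [← coe_substAlgHom hs, map_one]
    rw [subst_sub hs, h2, map_sub, map_one] at h1
    exact sub_eq_zero.1 h1
  · rw [derivative_subst hs, hF, mul_comm, derivative_exp]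

/-- A vector field `h · X ∂` with `h(0) ≠ 0` becomes linear in a suitable coordinate. -/
theorem exists_algEquiv_linearize {h : PowerSeries k} (hh : constantCoeff h ≠ 0) :
    ∃ ρ : PowerSeries k ≃ₐ[k] PowerSeries k, ∀ f,
      ρ (h * (X * derivative k f)) = constantCoeff h • (X * derivative k (ρ f)) := by
  set γ := constantCoeff h with hγ
  have hinv : h * h⁻¹ = 1 := PowerSeries.mul_inv_cancel h hh
  obtain ⟨q, hq⟩ : ∃ q : PowerSeries k, C γ * h⁻¹ = 1 + X * q := by
    have : X ∣ C γ * h⁻¹ - 1 := by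
      rw [X_dvd_iff]
      simp [hγ.symm, hh]
    obtain ⟨q, hq⟩ := this
    exact ⟨q, by rw [← hq]; ring⟩
  obtain ⟨v, hv1, hv⟩ := exists_derivative_eq_mul q
  -- the new coordinate `s` is an eigenvector of the vector field
  set s : PowerSeries k := X * v with hs
  have hs0 : constantCoeff s = 0 := by simp [hs]
  have hs1 : coeff 1 s = 1 := by
    rw [hs, ← zero_add 1, coeff_succ_X_mul, coeff_zero_eq_constantCoeff_apply, hv1]
  have hu : IsUnit (coeff 1 s) := by rw [hs1]; exact isUnit_one
  have heig : h * (X * derivative k s) = C γ * s := by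
    have h1 : derivative k s = C γ * h⁻¹ * v := by
      rw [hs, Derivation.leibniz, hv, derivative_X, hq, smul_eq_mul, smul_eq_mul]; ring
    rw [h1, hs]
    linear_combination (X * C γ * v) * hinv
  have hS : HasSubst s := HasSubst.of_constantCoeff_zero' hs0
  have hT : HasSubst (s.substInvOfIsUnit hu) := HasSubst.substInvOfIsUnit s hu
  have hST : ∀ f : PowerSeries k, subst (s.substInvOfIsUnit hu) (subst s f) = f := fun f => by
    rw [subst_comp_subst_apply hS hT, subst_substInvOfIsUnit_right s hs0 hu, X_subst]
  have hTS : ∀ f : PowerSeries k, subst s (subst (s.substInvOfIsUnit hu) f) = f := fun f => by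
    rw [subst_comp_subst_apply hT hS, subst_substInvOfIsUnit_left s hs0 hu, X_subst]
  let ρ : PowerSeries k ≃ₐ[k] PowerSeries k :=
    AlgEquiv.ofAlgHom (substAlgHom hT) (substAlgHom hS)
      (AlgHom.ext fun f => by
        simp only [AlgHom.comp_apply, coe_substAlgHom, AlgHom.id_apply]; exact hST f)
      (AlgHom.ext fun f => by
        simp only [AlgHom.comp_apply, coe_substAlgHom, AlgHom.id_apply]; exact hTS f)
  have hρ : ∀ f, ρ.symm f = f.subst s := fun f => by
    change substAlgHom hS f = _
    rw [coe_substAlgHom]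
  refine ⟨ρ, fun f => ?_⟩
  rw [← AlgEquiv.eq_symm_apply, map_smul, map_mul]
  obtain ⟨g, rfl⟩ := ρ.symm.surjective f
  rw [ρ.apply_symm_apply, hρ, hρ, hρ, derivative_subst hS, subst_X hS, smul_eq_C_mul]
  linear_combination (subst s (derivative k g)) * heig

end PowerSeries

/-! ### Derivations in terms of a parametrization -/

namespace CurveParametrization

variable {k A : Type*} [Field k] [CommRing A] [Algebra k A] (φ : CurveParametrization k A)

theorem constantCoeff_eq_zero [IsLocalRing A] {a : A}
    (ha : a ∈ maximalIdeal A) (p : minimalPrimes A) :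
    PowerSeries.constantCoeff (φ.toAlgHom a p) = 0 := by
  by_contra h
  set c := PowerSeries.constantCoeff (φ.toAlgHom a p)
  -- otherwise the unit `a - c` would vanish at the origin of the branch
  have hu : IsUnit (a - algebraMap k A c) := by
    by_contra hn
    have h1 : algebraMap k A c ∈ maximalIdeal A := by
      have := (maximalIdeal A).sub_mem ha ((mem_maximalIdeal _).2 hn)
      rwa [sub_sub_cancel] at this
    exact (mem_maximalIdeal _).1 h1 ((isUnit_iff_ne_zero.2 h).map (algebraMap k A))
  have h2 := (hu.map φ.toAlgHom).map (Pi.evalRingHom (fun _ : minimalPrimes A => PowerSeries k) p)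
  rw [Pi.evalRingHom_apply, PowerSeries.isUnit_iff_constantCoeff, map_sub, AlgHom.commutes] at h2
  refine h2.ne_zero ?_
  change PowerSeries.constantCoeff (φ.toAlgHom a p - PowerSeries.C c) = 0
  rw [map_sub, PowerSeries.constantCoeff_C, sub_self]

variable (χ : Derivation k A A)

/-- Minimal primes of `A` are stable under derivations. -/
theorem derivation_eq_zero_of_apply_eq_zero (p : minimalPrimes A) {a : A} [IsReduced A]
    (ha : φ.toAlgHom a p = 0) : φ.toAlgHom (χ a) p = 0 := by
  classical
  obtain ⟨N, -, hN⟩ := φ.exists_conductor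
  -- `u` vanishes on all other branches, so `a * u = 0`
  obtain ⟨u, hu⟩ := hN (Pi.single p 1)
  have h1 : a * u = 0 := φ.ext_of_apply_eq fun q => by
    rw [map_mul, Pi.mul_apply, hu, map_zero, Pi.zero_apply]
    by_cases hq : q = p
    · subst hq; rw [ha, zero_mul]
    · rw [Pi.single_eq_of_ne hq, mul_zero, mul_zero]
  have h2 := congrFun (congrArg (fun b => φ.toAlgHom (χ b)) h1) p
  simp only [Derivation.leibniz, smul_eq_mul, map_add, map_mul, Pi.add_apply, Pi.mul_apply,
    map_zero, Pi.zero_apply] at h2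
  rw [ha, zero_mul, zero_add, hu, Pi.single_eq_same, mul_one] at h2
  exact (mul_eq_zero.1 h2).resolve_left (pow_ne_zero N PowerSeries.X_ne_zero)

/-- On each branch, a derivation is a multiple of `∂`, up to the factor coming from the
conductor: both sides are derivations of `A` that agree on the powers of the parameter, and they
are continuous. -/
theorem derivation_mul_derivative_X_pow [CharZero k] [IsReduced A] {N : ℕ} (hN0 : 0 < N)
    (hN : ∀ g : minimalPrimes A → PowerSeries k,
      ∃ a : A, ∀ p, φ.toAlgHom a p = PowerSeries.X ^ N * g p) (p : minimalPrimes A) :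
    ∃ G : PowerSeries k, ∀ a, φ.toAlgHom (χ a) p *
      PowerSeries.derivative k (PowerSeries.X ^ N) =
        G * PowerSeries.derivative k (φ.toAlgHom a p) := by
  have hN' : ∀ g : PowerSeries k, ∃ a : A, φ.toAlgHom a p = PowerSeries.X ^ N * g := fun g =>
    (hN fun _ => g).imp fun a ha => ha p
  obtain ⟨w, hw⟩ := hN' 1
  rw [mul_one] at hw
  refine ⟨φ.toAlgHom (χ w) p, fun a => ?_⟩
  let _ : Module A (PowerSeries k) := Module.compHom (PowerSeries k)
    ((Pi.evalRingHom (fun _ => PowerSeries k) p).comp (φ.toAlgHom : A →+* _))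
  have hsmul : ∀ (b : A) (g : PowerSeries k), b • g = φ.toAlgHom b p * g := fun b g => rfl
  let θ : Derivation k A (PowerSeries k) :=
    { toFun := fun b => φ.toAlgHom (χ b) p * PowerSeries.derivative k (PowerSeries.X ^ N) -
        φ.toAlgHom (χ w) p * PowerSeries.derivative k (φ.toAlgHom b p)
      map_add' := fun b c => by
        simp only [map_add, Pi.add_apply]; ring
      map_smul' := fun r b => by
        simp only [Derivation.map_smul, map_smul, Pi.smul_apply, RingHom.id_apply, smul_sub,
          smul_mul_assoc, mul_smul_comm]
      map_one_eq_zero' := by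
        change φ.toAlgHom (χ 1) p * _ - _ * PowerSeries.derivative k (φ.toAlgHom 1 p) = 0
        rw [Derivation.map_one_eq_zero, map_one, Pi.one_apply, Derivation.map_one_eq_zero,
          map_zero, Pi.zero_apply, zero_mul, mul_zero, sub_zero]
      leibniz' := fun b c => by
        change φ.toAlgHom (χ (b * c)) p * _ - _ * PowerSeries.derivative k (φ.toAlgHom (b * c) p)
          = b • (φ.toAlgHom (χ c) p * _ - _) + c • (φ.toAlgHom (χ b) p * _ - _)
        rw [hsmul, hsmul, Derivation.leibniz, map_mul, Pi.mul_apply, Derivation.leibniz]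
        simp only [smul_eq_mul, map_add, map_mul, Pi.add_apply, Pi.mul_apply]
        ring }
  have hθ : ∀ b, θ b = φ.toAlgHom (χ b) p * PowerSeries.derivative k (PowerSeries.X ^ N) -
        φ.toAlgHom (χ w) p * PowerSeries.derivative k (φ.toAlgHom b p) := fun b => rfl
  have hθ0 : ∀ b c, φ.toAlgHom b p = φ.toAlgHom c p → θ b = θ c := by
    intro b c h
    rw [← sub_eq_zero, ← map_sub, hθ]
    have h0 : φ.toAlgHom (b - c) p = 0 := by rw [map_sub, Pi.sub_apply, h, sub_self]
    rw [φ.derivation_eq_zero_of_apply_eq_zero χ p h0, h0, map_zero, zero_mul, mul_zero, sub_zero]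
  have hw0 : θ w = 0 := by rw [hθ, hw, sub_self]
  choose s hs using hN'
  -- `θ` kills the elements with image `X ^ (N + i)`, as a power of them is a power of `w`
  have hz : ∀ i : ℕ, θ (s (PowerSeries.X ^ i)) = 0 := by
    intro i
    set z := s (PowerSeries.X ^ i) with hz
    have h1 : θ (z ^ N) = θ (w ^ (N + i)) := hθ0 _ _ (by
      rw [map_pow, map_pow, Pi.pow_apply, Pi.pow_apply, hw, hs]; ring)
    rw [Derivation.leibniz_pow, Derivation.leibniz_pow, hw0, smul_zero, smul_zero, hsmul,
      nsmul_eq_mul] at h1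
    have h2 : φ.toAlgHom (z ^ (N - 1)) p ≠ 0 := by
      rw [map_pow, Pi.pow_apply, hs, ← pow_add]
      exact pow_ne_zero _ (pow_ne_zero _ PowerSeries.X_ne_zero)
    have h3 : (N : PowerSeries k) ≠ 0 := by
      rw [← map_natCast (PowerSeries.C (R := k)), Ne,
        map_eq_zero_iff _ PowerSeries.C_injective]
      exact_mod_cast hN0.ne'
    exact (mul_eq_zero.1 ((mul_eq_zero.1 h1).resolve_left h3)).resolve_left h2
  have hdvd : ∀ r, PowerSeries.X ^ (N * r) ∣ PowerSeries.X ^ N * θ a := by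
    intro r
    set g := φ.toAlgHom a p with hg
    obtain ⟨g₂, h3⟩ := PowerSeries.exists_eq_sum_add_X_pow_mul (N * r) g
    have h1 : θ (w * a) = θ (∑ i ∈ Finset.range (N * r),
        PowerSeries.coeff i g • s (PowerSeries.X ^ i) + w ^ r * s g₂) := by
      refine hθ0 _ _ ?_
      rw [map_mul, map_add, map_mul, map_sum, Pi.mul_apply, Pi.add_apply, Finset.sum_apply,
        Pi.mul_apply, map_pow, Pi.pow_apply, hw, hs, ← hg]
      conv_lhs => rw [h3]
      rw [mul_add, Finset.mul_sum, pow_mul]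
      congr 1
      · refine Finset.sum_congr rfl fun i _ => ?_
        rw [map_smul, Pi.smul_apply, hs, mul_smul_comm]
      · ring
    rw [Derivation.leibniz, hw0, smul_zero, add_zero, hsmul, hw, map_add, map_sum,
      Finset.sum_eq_zero (fun i _ => by rw [Derivation.map_smul, hz, smul_zero]), zero_add,
      Derivation.leibniz, Derivation.leibniz_pow, hw0, smul_zero, smul_zero, smul_zero, add_zero,
      hsmul, map_pow, Pi.pow_apply, hw, ← pow_mul] at h1
    rw [h1]
    exact dvd_mul_right _ _
  have h := PowerSeries.eq_zero_of_forall_X_pow_mul_dvd hN0 hdvd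
  have h' := (mul_eq_zero.1 h).resolve_left (pow_ne_zero N PowerSeries.X_ne_zero)
  exact sub_eq_zero.1 h'

/-- If the image of `χ` generates the maximal ideal, then `χ` acts on every branch as `h · X ∂`
with a unit `h`. The order of `h` is found by comparing orders of elements of the maximal ideal on
the branch: the least one is neither lowered nor raised by `χ`. -/
theorem exists_isUnit_derivation_eq [CharZero k] [IsLocalRing A]
    (hA : IsReducedAlgebroidCurve k A) (hχ : GeneratesMaximalIdeal χ) (p : minimalPrimes A) :
    ∃ h : PowerSeries k, PowerSeries.constantCoeff h ≠ 0 ∧ ∀ a, φ.toAlgHom (χ a) p =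
      h * (PowerSeries.X * PowerSeries.derivative k (φ.toAlgHom a p)) := by
  classical
  have := hA.reduced
  have hχm : ∀ a, χ a ∈ maximalIdeal A := fun a => hχ ▸ Ideal.subset_span ⟨a, rfl⟩
  obtain ⟨N, hN0, hN⟩ := φ.exists_conductor
  obtain ⟨G, hG⟩ := φ.derivation_mul_derivative_X_pow χ hN0 hN p
  -- `e` is the least order on the branch of an element of the maximal ideal
  have hex : ∃ e : ℕ, ∃ a ∈ maximalIdeal A, ∃ v : PowerSeries k,
      PowerSeries.constantCoeff v ≠ 0 ∧ φ.toAlgHom a p = PowerSeries.X ^ e * v := by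
    obtain ⟨x, hxm, hx⟩ := hA.exists_parameter
    have h0 : φ.toAlgHom x p ≠ 0 := fun h => hx p.1 p.2 ((φ.apply_eq_zero_iff _ _).1 h)
    obtain ⟨n, v, hv⟩ := IsDiscreteValuationRing.eq_unit_mul_pow_irreducible h0
      PowerSeries.X_prime.irreducible
    exact ⟨n, x, hxm, v, (PowerSeries.isUnit_iff_constantCoeff.1 v.isUnit).ne_zero,
      by rw [hv, mul_comm]⟩
  set e := Nat.find hex with he
  obtain ⟨a₀, ha₀, v, hv0, hv⟩ := Nat.find_spec hex
  rw [← he] at hv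
  have hmin : ∀ b ∈ maximalIdeal A, PowerSeries.X ^ e ∣ φ.toAlgHom b p := by
    intro b hb
    by_cases h0 : φ.toAlgHom b p = 0
    · rw [h0]; exact dvd_zero _
    obtain ⟨n, v, hv⟩ := IsDiscreteValuationRing.eq_unit_mul_pow_irreducible h0
      PowerSeries.X_prime.irreducible
    have hle : e ≤ n := Nat.find_min' hex ⟨b, hb, v,
      (PowerSeries.isUnit_iff_constantCoeff.1 v.isUnit).ne_zero, by rw [hv, mul_comm]⟩
    rw [hv]
    exact (pow_dvd_pow _ hle).mul_left _
  have he0 : e ≠ 0 := by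
    intro h0
    have := φ.constantCoeff_eq_zero ha₀ p
    rw [hv, h0, pow_zero, one_mul] at this
    exact hv0 this
  have hNk : (N : k) ≠ 0 := by exact_mod_cast hN0.ne'
  have hXN : PowerSeries.X * PowerSeries.derivative k (PowerSeries.X ^ N) =
      PowerSeries.X ^ N * PowerSeries.C (N : k) := by
    have := PowerSeries.X_mul_derivative_X_pow_mul N (1 : PowerSeries k)
    rwa [mul_one, mul_one, Derivation.map_one_eq_zero, mul_zero, add_zero,
      ← map_natCast (PowerSeries.C (R := k))] at this
  -- the order of `G` is at least `N`
  obtain ⟨c, hc⟩ := hmin _ (hχm a₀)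
  set y : PowerSeries k := (e : PowerSeries k) * v + PowerSeries.X * PowerSeries.derivative k v
    with hy
  have hy0 : PowerSeries.constantCoeff y ≠ 0 := by
    rw [hy, map_add, map_mul, map_mul, PowerSeries.constantCoeff_X, zero_mul, add_zero,
      map_natCast]
    exact mul_ne_zero (Nat.cast_ne_zero.2 he0) hv0
  have hyi : y * y⁻¹ = 1 := PowerSeries.mul_inv_cancel y hy0
  have hXe : (PowerSeries.X ^ e : PowerSeries k) ≠ 0 := pow_ne_zero e PowerSeries.X_ne_zero
  have hGeq : G = PowerSeries.X ^ N * PowerSeries.C (N : k) * (c * y⁻¹) := by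
    have h1 := congrArg (PowerSeries.X * ·) (hG a₀)
    have h2 : PowerSeries.X ^ e * (PowerSeries.X ^ N * PowerSeries.C (N : k) * c) =
        PowerSeries.X ^ e * (G * y) := by
      rw [hc] at h1
      have h3 := PowerSeries.X_mul_derivative_X_pow_mul e v
      rw [← hv, ← hy] at h3
      linear_combination h1 - PowerSeries.X ^ e * c * hXN + G * h3
    have h4 := mul_left_cancel₀ hXe h2
    linear_combination (-y⁻¹) * h4 - G * hyi
  have hmain : ∀ a, φ.toAlgHom (χ a) p = (c * y⁻¹) *
      (PowerSeries.X * PowerSeries.derivative k (φ.toAlgHom a p)) := by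
    intro a
    have h1 : PowerSeries.X ^ N * PowerSeries.C (N : k) * φ.toAlgHom (χ a) p =
        PowerSeries.X ^ N * PowerSeries.C (N : k) * ((c * y⁻¹) *
          (PowerSeries.X * PowerSeries.derivative k (φ.toAlgHom a p))) := by
      have := hG a
      rw [hGeq] at this
      linear_combination PowerSeries.X * this - φ.toAlgHom (χ a) p * hXN
    refine mul_left_cancel₀ (mul_ne_zero (pow_ne_zero N PowerSeries.X_ne_zero) ?_) h1
    rw [Ne, map_eq_zero_iff _ PowerSeries.C_injective]
    exact hNk
  refine ⟨c * y⁻¹, fun h0 => ?_, hmain⟩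
  -- otherwise `χ` raises the order on the branch of every element of the maximal ideal
  have hdvd : ∀ a, PowerSeries.X ^ (e + 1) ∣ φ.toAlgHom (χ a) p := by
    intro a
    obtain ⟨r, hr⟩ := hA.exists_sub_algebraMap_mem a
    obtain ⟨g, hg⟩ := hmin _ hr
    have h1 : χ a = χ (a - algebraMap k A r) := by
      rw [map_sub, Derivation.map_algebraMap, sub_zero]
    obtain ⟨h', hh'⟩ := PowerSeries.X_dvd_iff.2 h0
    rw [h1, hmain, hg, PowerSeries.X_mul_derivative_X_pow_mul, hh', pow_succ]
    exact ⟨h' * ((e : PowerSeries k) * g + PowerSeries.X * PowerSeries.derivative k g), by ring⟩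
  have hle : maximalIdeal A ≤ (Ideal.span {PowerSeries.X ^ (e + 1)} : Ideal (PowerSeries k)).comap
      ((Pi.evalRingHom (fun _ => PowerSeries k) p).comp (φ.toAlgHom : A →+* _)) := by
    rw [← hχ, Ideal.span_le]
    rintro _ ⟨a, rfl⟩
    exact Ideal.mem_span_singleton.2 (hdvd a)
  have h2 : PowerSeries.X ^ (e + 1) ∣ φ.toAlgHom a₀ p := Ideal.mem_span_singleton.1 (hle ha₀)
  rw [hv, pow_succ] at h2
  exact hv0 (PowerSeries.X_dvd_iff.1 ((mul_dvd_mul_iff_left hXe).1 h2))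

/-- Change of coordinates on every branch. -/
noncomputable def trans (ρ : minimalPrimes A → (PowerSeries k ≃ₐ[k] PowerSeries k)) :
    CurveParametrization k A where
  toAlgHom := (AlgHom.pi fun p => ((ρ p : PowerSeries k →ₐ[k] PowerSeries k).comp
    (Pi.evalAlgHom k _ p))).comp φ.toAlgHom
  apply_eq_zero_iff a p := by
    rw [← φ.apply_eq_zero_iff]
    exact map_eq_zero_iff (ρ p) (ρ p).injective
  isIntegral := by
    let T : (minimalPrimes A → PowerSeries k) →ₐ[k] (minimalPrimes A → PowerSeries k) :=
      AlgHom.pi fun p => (ρ p : PowerSeries k →ₐ[k] PowerSeries k).comp (Pi.evalAlgHom k _ p)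
    refine φ.isIntegral.trans _ (T : _ →+* (minimalPrimes A → PowerSeries k))
      (RingHom.isIntegral_of_surjective _ fun g => ?_)
    exact ⟨fun p => (ρ p).symm (g p), funext fun p => (ρ p).apply_symm_apply (g p)⟩
  exists_conductor := by
    obtain ⟨N, hN0, hN⟩ := φ.exists_conductor
    refine ⟨N, hN0, fun g => ?_⟩
    have hX : ∀ p, ∃ u, (ρ p).symm PowerSeries.X = PowerSeries.X * u := by
      intro p
      have hn : ¬ IsUnit ((ρ p).symm PowerSeries.X) := fun h =>
        PowerSeries.X_prime.not_isUnit (by simpa using h.map (ρ p))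
      rw [PowerSeries.isUnit_iff_constantCoeff, isUnit_iff_ne_zero, not_not] at hn
      exact PowerSeries.X_dvd_iff.2 hn
    choose u hu using hX
    obtain ⟨a, ha⟩ := hN fun p => u p ^ N * (ρ p).symm (g p)
    refine ⟨a, fun p => ?_⟩
    change ρ p (φ.toAlgHom a p) = _
    rw [ha, ← mul_assoc, ← mul_pow, ← hu, map_mul, map_pow, AlgEquiv.apply_symm_apply,
      AlgEquiv.apply_symm_apply]

end CurveParametrization

/-- In suitable coordinates on the branches, `χ` is a vector field `γ · X ∂` with nonzero `γ`. -/
theorem exists_euler_parametrization {k A : Type*} [Field k] [IsAlgClosed k] [CharZero k]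
    [CommRing A] [IsLocalRing A] [Algebra k A] (hA : IsReducedAlgebroidCurve k A)
    (χ : Derivation k A A) (hχ : GeneratesMaximalIdeal χ) :
    ∃ (φ : CurveParametrization k A) (γ : minimalPrimes A → k), (∀ p, γ p ≠ 0) ∧
      ∀ a p, φ.toAlgHom (χ a) p =
        γ p • (PowerSeries.X * PowerSeries.derivative k (φ.toAlgHom a p)) := by
  obtain ⟨φ⟩ := hA.nonempty_curveParametrization
  choose h hh0 hh using φ.exists_isUnit_derivation_eq χ hA hχ
  choose ρ hρ using fun p => PowerSeries.exists_algEquiv_linearize (hh0 p)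
  refine ⟨φ.trans ρ, fun p => PowerSeries.constantCoeff (h p), hh0, fun a p => ?_⟩
  change ρ p (φ.toAlgHom (χ a) p) = _ • (_ * PowerSeries.derivative k (ρ p (φ.toAlgHom a p)))
  rw [hh, hρ]

/-! ### The Euler vector field on the normalization -/

/-- The vector field `γ · X ∂` on a product of formal lines. -/
noncomputable def eulerDerivation {k ι : Type*} [Field k] (γ : ι → k) :
    Derivation k (ι → PowerSeries k) (ι → PowerSeries k) :=
  Derivation.mk'
    { toFun := fun g p => γ p • (PowerSeries.X * PowerSeries.derivative k (g p))
      map_add' := fun g h => by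
        funext p
        simp only [Pi.add_apply, map_add, mul_add, smul_add]
      map_smul' := fun c g => by
        funext p
        simp only [Pi.smul_apply, Derivation.map_smul, mul_smul_comm, RingHom.id_apply]
        rw [smul_comm] }
    fun g h => by
      funext p
      simp only [LinearMap.coe_mk, AddHom.coe_mk, Pi.mul_apply, Derivation.leibniz, Pi.add_apply,
        smul_eq_mul, PowerSeries.smul_eq_C_mul]
      ring

theorem eulerDerivation_apply {k ι : Type*} [Field k] (γ : ι → k) (g : ι → PowerSeries k) (p : ι) :
    eulerDerivation γ g p = γ p • (PowerSeries.X * PowerSeries.derivative k (g p)) := rfl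

theorem NormalizationCoordinates.exists_isEulerIn {k A : Type*} [Field k] [CommRing A] [Algebra k A]
    (t : NormalizationCoordinates k A) (γ : minimalPrimes A → k) :
    ∃ D : Derivation k (Normalization A) (Normalization A), IsEulerIn t γ D := by
  let D := Derivation.mk' (R := k) (A := Normalization A) (M := Normalization A)
    (t.toAlgEquiv.symm.toLinearMap ∘ₗ (eulerDerivation γ : _ →ₗ[k] _) ∘ₗ t.toAlgEquiv.toLinearMap)
    fun x y => by
      simp only [LinearMap.comp_apply, AlgEquiv.toLinearMap_apply, Derivation.coeFn_coe, map_mul,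
        Derivation.leibniz, smul_eq_mul, map_add, AlgEquiv.symm_apply_apply]
  refine ⟨D, fun x p => ?_⟩
  have : t.toAlgEquiv (D x) = eulerDerivation γ (t.toAlgEquiv x) :=
    t.toAlgEquiv.apply_symm_apply _
  rw [this, eulerDerivation_apply]

/-! ### Eigenvectors -/

theorem PowerSeries.coeff_X_mul_derivative {k : Type*} [Field k] (f : PowerSeries k) (n : ℕ) :
    coeff n (X * derivative k f) = n * coeff n f := by
  cases n with
  | zero => simp
  | succ n => rw [coeff_succ_X_mul, coeff_derivative, Nat.cast_succ, mul_comm]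

namespace CurveParametrization

variable {k A : Type*} [Field k] [CommRing A] [Algebra k A] (φ : CurveParametrization k A)

/-- In the parametrization `φ`, the derivation `χ` of `A` is `γ · X ∂`. -/
def IsEuler (χ : Derivation k A A) (γ : minimalPrimes A → k) : Prop :=
  ∀ a p, φ.toAlgHom (χ a) p =
    γ p • (PowerSeries.X * PowerSeries.derivative k (φ.toAlgHom a p))

theorem mem_maximalIdeal_of_constantCoeff [IsLocalRing A] (hA : IsReducedAlgebroidCurve k A)
    {a : A} (p : minimalPrimes A) (ha : PowerSeries.constantCoeff (φ.toAlgHom a p) = 0) :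
    a ∈ maximalIdeal A := by
  obtain ⟨c, hc⟩ := hA.exists_sub_algebraMap_mem a
  have h := φ.constantCoeff_eq_zero hc p
  rw [map_sub, AlgHom.commutes] at h
  change PowerSeries.constantCoeff (φ.toAlgHom a p - PowerSeries.C c) = 0 at h
  rw [map_sub, ha, PowerSeries.constantCoeff_C, zero_sub, neg_eq_zero] at h
  rwa [h, map_zero, sub_zero] at hc

theorem ext_coeff [IsReduced A] {a b : A}
    (h : ∀ p n, PowerSeries.coeff n (φ.toAlgHom a p) = PowerSeries.coeff n (φ.toAlgHom b p)) :
    a = b :=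
  φ.ext_of_apply_eq fun p => PowerSeries.ext (h p)

variable {φ} {χ : Derivation k A A} {γ : minimalPrimes A → k}

theorem IsEuler.coeff_apply (h : φ.IsEuler χ γ) (a : A) (p : minimalPrimes A) (n : ℕ) :
    PowerSeries.coeff n (φ.toAlgHom (χ a) p) = γ p * n * PowerSeries.coeff n (φ.toAlgHom a p) := by
  rw [h, map_smul, PowerSeries.coeff_X_mul_derivative, smul_eq_mul, mul_assoc]

theorem IsEuler.coeff_aeval (h : φ.IsEuler χ γ) (P : Polynomial k) (a : A) (p : minimalPrimes A)
    (n : ℕ) : PowerSeries.coeff n (φ.toAlgHom (Polynomial.aeval (χ : A →ₗ[k] A) P a) p) =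
      P.eval (γ p * n) * PowerSeries.coeff n (φ.toAlgHom a p) := by
  induction P using Polynomial.induction_on' with
  | add P Q hP hQ =>
    rw [map_add, LinearMap.add_apply, map_add, Pi.add_apply, map_add, hP, hQ, Polynomial.eval_add,
      add_mul]
  | monomial i c =>
    rw [Polynomial.aeval_monomial, Polynomial.eval_monomial, ← Algebra.smul_def,
      LinearMap.smul_apply, map_smul, Pi.smul_apply, map_smul, smul_eq_mul, mul_assoc]
    congr 1
    induction i with
    | zero => simp
    | succ i ih =>
      rw [pow_succ', Module.End.mul_apply, pow_succ', mul_assoc, ← ih]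
      exact h.coeff_apply _ p n

/-- The weights of an eigenvector are the `n` with `γ p * n` equal to the eigenvalue. -/
theorem IsEuler.eq_of_coeff_ne_zero (h : φ.IsEuler χ γ) {a : A} {c : k} (ha : χ a = c • a)
    {p : minimalPrimes A} {n : ℕ} (hn : PowerSeries.coeff n (φ.toAlgHom a p) ≠ 0) :
    γ p * n = c := by
  have h1 := h.coeff_apply a p n
  rw [ha, map_smul, Pi.smul_apply, map_smul, smul_eq_mul] at h1
  exact (mul_right_cancel₀ hn h1).symm

theorem IsEuler.exists_eq_mul_of_mem_eigenvalues [IsLocalRing A] [IsReduced A]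
    (h : φ.IsEuler χ γ) {c : k} (hc : c ∈ eigenvaluesOnMaximalIdeal χ) :
    ∃ (p : minimalPrimes A) (n : ℕ), 0 < n ∧ c = γ p * n := by
  obtain ⟨x, hx, hev⟩ := hc
  have hex : ∃ p n, PowerSeries.coeff n (φ.toAlgHom x p) ≠ 0 := by
    by_contra! hcon
    exact hev.2 (φ.ext_coeff fun p n => by rw [hcon, map_zero, Pi.zero_apply, map_zero])
  obtain ⟨p, n, hn⟩ := hex
  refine ⟨p, n, Nat.pos_of_ne_zero fun h0 => hn ?_,
    (h.eq_of_coeff_ne_zero hev.apply_eq_smul hn).symm⟩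
  rw [h0, PowerSeries.coeff_zero_eq_constantCoeff_apply]
  exact φ.constantCoeff_eq_zero hx p

/-- Every element of the maximal ideal is a sum of eigenvectors, up to an element of high order.
The components are extracted by Lagrange interpolation polynomials in `χ`, hence lie in `A`. -/
theorem IsEuler.exists_eq_sum_eigenvectors_add [IsLocalRing A] (hA : IsReducedAlgebroidCurve k A)
    (h : φ.IsEuler χ γ) {M : ℕ} (hM0 : 0 < M)
    (hM : ∀ g : minimalPrimes A → PowerSeries k,
      ∃ a : A, ∀ p, φ.toAlgHom a p = PowerSeries.X ^ M * g p)
    {a : A} (ha : a ∈ maximalIdeal A) :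
    ∃ (S : Finset k) (u : k → A) (b : A) (g : minimalPrimes A → PowerSeries k),
      (∀ c ∈ S, u c ∈ maximalIdeal A ∧ χ (u c) = c • u c) ∧
      (∀ p, φ.toAlgHom b p = PowerSeries.X ^ M * g p) ∧ a = ∑ c ∈ S, u c + b := by
  classical
  have := hA.finite_minimalPrimes
  have := hA.reduced
  cases nonempty_fintype (minimalPrimes A)
  choose g hg using fun p => PowerSeries.exists_eq_sum_add_X_pow_mul M (φ.toAlgHom a p)
  obtain ⟨b, hb⟩ := hM g
  -- `0` is added to the set of weights so that it is not empty
  let S : Finset k := insert 0 ((Finset.univ ×ˢ Finset.range M).image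
    fun x : minimalPrimes A × ℕ => γ x.1 * x.2)
  have hcoeff : ∀ p n, M ≤ n → PowerSeries.coeff n (φ.toAlgHom (a - b) p) = 0 := by
    intro p n hn
    rw [map_sub, Pi.sub_apply, hb, hg p, add_sub_cancel_right, map_sum]
    refine Finset.sum_eq_zero fun i hi => ?_
    have := Finset.mem_range.1 hi
    rw [map_smul, PowerSeries.coeff_X_pow, if_neg (by omega), smul_zero]
  have hS : ∀ p n, n < M → γ p * n ∈ S := fun p n hn =>
    Finset.mem_insert_of_mem (Finset.mem_image.2
      ⟨(p, n), Finset.mem_product.2 ⟨Finset.mem_univ _, Finset.mem_range.2 hn⟩, rfl⟩)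
  let u : k → A := fun c => Polynomial.aeval (χ : A →ₗ[k] A) (Lagrange.basis S id c) (a - b)
  refine ⟨S, u, b, g, fun c hc => ⟨?_, ?_⟩, hb, ?_⟩
  · obtain ⟨⟨p, hp⟩⟩ : Nonempty (minimalPrimes A) := by
      obtain ⟨p, hp, -⟩ := Ideal.exists_minimalPrimes_le (bot_le : ⊥ ≤ maximalIdeal A)
      exact ⟨⟨p, hp⟩⟩
    refine φ.mem_maximalIdeal_of_constantCoeff hA ⟨p, hp⟩ ?_
    rw [← PowerSeries.coeff_zero_eq_constantCoeff_apply, h.coeff_aeval, map_sub, Pi.sub_apply, hb,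
      map_sub, PowerSeries.coeff_zero_eq_constantCoeff_apply,
      PowerSeries.coeff_zero_eq_constantCoeff_apply, φ.constantCoeff_eq_zero ha, map_mul, map_pow,
      PowerSeries.constantCoeff_X, zero_pow hM0.ne', zero_mul, sub_zero, mul_zero]
  · refine φ.ext_coeff fun p n => ?_
    rw [h.coeff_apply, map_smul, Pi.smul_apply, map_smul, smul_eq_mul, h.coeff_aeval]
    by_cases hn : n < M
    · by_cases hcn : γ p * n = c
      · rw [hcn]
      · have : Polynomial.eval (γ p * n) (Lagrange.basis S id c) = 0 :=
          Lagrange.eval_basis_of_ne (v := id) (Ne.symm hcn) (hS p n hn)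
        rw [this, zero_mul, mul_zero, mul_zero]
    · rw [hcoeff p n (not_lt.1 hn), mul_zero, mul_zero, mul_zero]
  · have h1 : ∑ c ∈ S, u c = a - b := by
      simp only [u]
      rw [← LinearMap.sum_apply, ← map_sum, Lagrange.sum_basis Function.injective_id.injOn
        ⟨0, Finset.mem_insert_self _ _⟩, map_one, Module.End.one_apply]
    rw [h1, sub_add_cancel]

theorem IsEuler.isDiagonalizable [IsLocalRing A] (hA : IsReducedAlgebroidCurve k A)
    (h : φ.IsEuler χ γ) : IsDiagonalizableDerivation χ := by
  have := hA.noetherian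
  have := hA.reduced
  refine le_antisymm (Ideal.span_le.2 fun x hx => hx.1) ?_
  obtain ⟨N, hN0, hN⟩ := φ.exists_conductor
  have hmem : ∀ (b : A) (g : minimalPrimes A → PowerSeries k),
      (∀ p, φ.toAlgHom b p = PowerSeries.X ^ N * g p) → b ∈ maximalIdeal A := by
    intro b g hb
    obtain ⟨p, hp, -⟩ := Ideal.exists_minimalPrimes_le (bot_le : ⊥ ≤ maximalIdeal A)
    refine φ.mem_maximalIdeal_of_constantCoeff hA ⟨p, hp⟩ ?_
    rw [hb, map_mul, map_pow, PowerSeries.constantCoeff_X, zero_pow hN0.ne', zero_mul]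
  -- Nakayama: elements of order at least `2 * N` are in the square of the maximal ideal
  refine Submodule.le_of_le_smul_of_le_jacobson_bot (I := maximalIdeal A) (IsNoetherian.noetherian _)
    (maximalIdeal_le_jacobson _) fun a ha => ?_
  obtain ⟨S, u, b, g, hu, hb, rfl⟩ := h.exists_eq_sum_eigenvectors_add hA (M := N + N) (by omega)
    (fun g => by
      obtain ⟨a, ha⟩ := hN fun p => PowerSeries.X ^ N * g p
      exact ⟨a, fun p => by rw [ha, pow_add, mul_assoc]⟩) ha
  refine Submodule.add_mem_sup (Submodule.sum_mem _ fun c hc => ?_) ?_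
  · by_cases h0 : u c = 0
    · rw [h0]; exact Submodule.zero_mem _
    · exact Ideal.subset_span ⟨(hu c hc).1, c, Module.End.mem_eigenspace_iff.2 (hu c hc).2, h0⟩
  · obtain ⟨b₁, hb₁⟩ := hN 1
    obtain ⟨b₂, hb₂⟩ := hN g
    have : b = b₁ * b₂ := φ.ext_of_apply_eq fun p => by
      rw [hb, map_mul, Pi.mul_apply, hb₁, hb₂, Pi.one_apply]; ring
    rw [this, smul_eq_mul]
    exact Ideal.mul_mem_mul (hmem b₁ _ hb₁) (hmem b₂ _ hb₂)

theorem IsEuler.generatesMaximalIdeal [IsLocalRing A] (hA : IsReducedAlgebroidCurve k A)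
    (h : φ.IsEuler χ γ) (hne : ∀ c ∈ eigenvaluesOnMaximalIdeal χ, c ≠ 0) :
    GeneratesMaximalIdeal χ := by
  refine le_antisymm (Ideal.span_le.2 ?_) ?_
  · rintro _ ⟨a, rfl⟩
    obtain ⟨p, hp, -⟩ := Ideal.exists_minimalPrimes_le (bot_le : ⊥ ≤ maximalIdeal A)
    refine φ.mem_maximalIdeal_of_constantCoeff hA ⟨p, hp⟩ ?_
    rw [← PowerSeries.coeff_zero_eq_constantCoeff_apply, h.coeff_apply, Nat.cast_zero, mul_zero,
      zero_mul]
  · rw [← h.isDiagonalizable hA, Ideal.span_le]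
    rintro x ⟨hx, c, hev⟩
    have h1 : x = algebraMap k A c⁻¹ * χ x := by
      have h2 : χ x = c • x := hev.apply_eq_smul
      rw [h2, ← Algebra.smul_def, smul_smul, inv_mul_cancel₀ (hne c ⟨x, hx, hev⟩), one_smul]
    rw [h1]
    exact Ideal.mul_mem_left _ _ (Ideal.subset_span ⟨x, rfl⟩)

/-! ### Positive integer weights -/

/-- If `δ` satisfies all the coincidences `γ p * i = γ q * j` between weights of `γ`, then
`δ · X ∂` is constant on the eigenvectors of `γ · X ∂`, hence preserves `A`. -/
theorem IsEuler.exists_isEuler_of_weights [IsLocalRing A] (hA : IsReducedAlgebroidCurve k A)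
    (h : φ.IsEuler χ γ) {δ : minimalPrimes A → k}
    (hδ : ∀ (p q : minimalPrimes A) (i j : ℕ), γ p * i = γ q * j → δ p * i = δ q * j) :
    ∃ χ' : Derivation k A A, φ.IsEuler χ' δ := by
  have := hA.reduced
  obtain ⟨N, hN0, hN⟩ := φ.exists_conductor
  have hex : ∀ a : A, ∃ a' : A, φ.toAlgHom a' = eulerDerivation δ (φ.toAlgHom a) := by
    intro a
    obtain ⟨r, hr⟩ := hA.exists_sub_algebraMap_mem a
    obtain ⟨S, u, b, g, hu, hb, hab⟩ := h.exists_eq_sum_eigenvectors_add hA hN0 hN hr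
    have huS : ∀ c ∈ S, ∃ l : k, φ.toAlgHom (l • u c) = eulerDerivation δ (φ.toAlgHom (u c)) := by
      intro c hc
      by_cases h0 : ∃ q j, PowerSeries.coeff j (φ.toAlgHom (u c) q) ≠ 0
      · obtain ⟨q, j, hj⟩ := h0
        refine ⟨δ q * j, funext fun p => PowerSeries.ext fun i => ?_⟩
        rw [eulerDerivation_apply, map_smul, map_smul, Pi.smul_apply, map_smul,
          PowerSeries.coeff_X_mul_derivative, smul_eq_mul, smul_eq_mul, ← mul_assoc]
        by_cases hi : PowerSeries.coeff i (φ.toAlgHom (u c) p) = 0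
        · rw [hi, mul_zero, mul_zero]
        · rw [hδ p q i j ((h.eq_of_coeff_ne_zero (hu c hc).2 hi).trans
            (h.eq_of_coeff_ne_zero (hu c hc).2 hj).symm)]
      · push Not at h0
        have : u c = 0 := φ.ext_coeff fun p n => by rw [h0, map_zero, Pi.zero_apply, map_zero]
        exact ⟨0, by rw [this, smul_zero, map_zero, map_zero]⟩
    choose! l hl using huS
    obtain ⟨b', hb'⟩ := hN fun p => δ p •
      ((N : PowerSeries k) * g p + PowerSeries.X * PowerSeries.derivative k (g p))
    have hb'' : φ.toAlgHom b' = eulerDerivation δ (φ.toAlgHom b) := by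
      funext p
      rw [hb', eulerDerivation_apply, hb, PowerSeries.X_mul_derivative_X_pow_mul, mul_smul_comm]
    refine ⟨∑ c ∈ S, l c • u c + b', ?_⟩
    have ha : a = algebraMap k A r + (∑ c ∈ S, u c + b) := by rw [← hab]; ring
    rw [ha, map_add, map_sum, Finset.sum_congr rfl hl, hb'', map_add, map_add, map_add,
      AlgHom.commutes, Derivation.map_algebraMap, zero_add, map_sum, map_add, map_sum]
  choose χ' hχ' using hex
  have hinj : ∀ a b, φ.toAlgHom a = φ.toAlgHom b → a = b := fun a b hab =>
    φ.ext_of_apply_eq fun p => congrFun hab p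
  refine ⟨Derivation.mk'
    { toFun := χ'
      map_add' := fun a b => hinj _ _ (by rw [hχ', map_add, map_add, map_add, hχ', hχ'])
      map_smul' := fun c a => hinj _ _ (by
        rw [hχ', map_smul, Derivation.map_smul, RingHom.id_apply, map_smul, hχ']) }
    fun a b => hinj _ _ (by
      simp only [LinearMap.coe_mk, AddHom.coe_mk, smul_eq_mul, map_add, map_mul, hχ',
        Derivation.leibniz]), fun a p => ?_⟩
  exact congrFun (hχ' a) p

end CurveParametrization

/-- Grouping the `γ p` by commensurability and choosing in each group a common unit gives positive
integers with the same coincidences between multiples. -/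
theorem exists_pos_nat_weights {k ι : Type*} [Field k] [CharZero k] [Finite ι] {γ : ι → k}
    (hγ : ∀ p, γ p ≠ 0) : ∃ n : ι → ℕ, (∀ p, 0 < n p) ∧
      ∀ (p q : ι) (i j : ℕ), γ p * i = γ q * j → n p * i = n q * j := by
  classical
  cases nonempty_fintype ι
  let s : Setoid ι :=
    { r := fun p q => ∃ a b : ℕ, 0 < a ∧ 0 < b ∧ γ p * a = γ q * b
      iseqv :=
        { refl := fun p => ⟨1, 1, one_pos, one_pos, rfl⟩
          symm := fun ⟨a, b, ha, hb, h⟩ => ⟨b, a, hb, ha, h.symm⟩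
          trans := fun ⟨a, b, ha, hb, h⟩ ⟨a', b', ha', hb', h'⟩ =>
            ⟨a * a', b * b', Nat.mul_pos ha ha', Nat.mul_pos hb hb', by
              push_cast
              linear_combination (a' : k) * h + (b : k) * h'⟩ } }
  have hs : ∀ p, ∃ a b : ℕ, 0 < a ∧ 0 < b ∧ γ p * a = γ (Quotient.mk s p).out * b := fun p =>
    s.symm (Quotient.mk_out (s := s) p)
  choose a b ha hb hab using hs
  refine ⟨fun p => b p * ∏ q ∈ Finset.univ.erase p, a q,
    fun p => Nat.mul_pos (hb p) (Finset.prod_pos fun q _ => ha q), fun p q i j h => ?_⟩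
  rcases Nat.eq_zero_or_pos i with rfl | hi
  · have : j = 0 := by
      rw [Nat.cast_zero, mul_zero, eq_comm, mul_eq_zero] at h
      exact_mod_cast h.resolve_left (hγ q)
    rw [this, mul_zero, mul_zero]
  have hj : 0 < j := by
    refine Nat.pos_of_ne_zero fun h0 => ?_
    rw [h0, Nat.cast_zero, mul_zero, mul_eq_zero] at h
    exact hi.ne' (by exact_mod_cast h.resolve_left (hγ p))
  have hpq : Quotient.mk s p = Quotient.mk s q := Quotient.sound ⟨i, j, hi, hj, h⟩
  have hq := hab q
  rw [← hpq] at hq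
  have hp := hab p
  have key : b p * i * a q = b q * j * a p := by
    have : γ (Quotient.mk s p).out * ((b p * i * a q : ℕ) : k) =
        γ (Quotient.mk s p).out * ((b q * j * a p : ℕ) : k) := by
      push_cast
      linear_combination (a p * a q : k) * h - (i * a q : k) * hp + (j * a p : k) * hq
    exact_mod_cast mul_left_cancel₀ (hγ _) this
  have hTp := Finset.mul_prod_erase Finset.univ a (Finset.mem_univ p)
  have hTq := Finset.mul_prod_erase Finset.univ a (Finset.mem_univ q)
  refine Nat.eq_of_mul_eq_mul_left (Nat.mul_pos (ha p) (ha q)) ?_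
  calc _ = b p * i * a q * (a p * ∏ x ∈ Finset.univ.erase p, a x) := by ring
    _ = b q * j * a p * (a q * ∏ x ∈ Finset.univ.erase q, a x) := by rw [key, hTp, hTq]
    _ = _ := by ring

theorem proposition34 {k A : Type*} [Field k] [IsAlgClosed k] [CharZero k]
    [CommRing A] [IsLocalRing A] [Algebra k A] (hA : IsReducedAlgebroidCurve k A)
    (χ : Derivation k A A) (hχ : GeneratesMaximalIdeal χ) :
    (∃ D : Derivation k (Normalization A) (Normalization A),
      IsLiftToNormalization χ D ∧
      (∀ D' : Derivation k (Normalization A) (Normalization A),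
        IsLiftToNormalization χ D' → D' = D) ∧
      ∃ (t : NormalizationCoordinates k A) (γ : minimalPrimes A → k), IsEulerIn t γ D) ∧
    (IsDiagonalizableDerivation χ ∧ ∀ c ∈ eigenvaluesOnMaximalIdeal χ, c ≠ 0) ∧
    ∃ χ' : Derivation k A A, GeneratesMaximalIdeal χ' ∧ IsDiagonalizableDerivation χ' ∧
      ∀ c ∈ eigenvaluesOnMaximalIdeal χ', ∃ n : ℕ, 0 < n ∧ c = (n : k) := by
  have := hA.reduced
  have := hA.finite_minimalPrimes
  obtain ⟨φ, γ, hγ, hE⟩ := exists_euler_parametrization hA χ hχ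
  replace hE : φ.IsEuler χ γ := hE
  refine ⟨?_, ⟨hE.isDiagonalizable hA, fun c hc => ?_⟩, ?_⟩
  · obtain ⟨t, ht⟩ := φ.exists_coordinates
    obtain ⟨D, hD⟩ := t.exists_isEulerIn γ
    have hlift : IsLiftToNormalization χ D := fun a => t.toAlgEquiv.injective <| funext fun p => by
      rw [hD, ht, ht, hE]
    exact ⟨D, hlift, fun D' hD' => hlift.unique hD', t, γ, hD⟩
  · obtain ⟨p, n, hn, rfl⟩ := hE.exists_eq_mul_of_mem_eigenvalues hc
    exact mul_ne_zero (hγ p) (Nat.cast_ne_zero.2 hn.ne')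
  · obtain ⟨n, hn, hnγ⟩ := exists_pos_nat_weights hγ
    obtain ⟨χ', hχ'⟩ := hE.exists_isEuler_of_weights hA (δ := fun p => (n p : k))
      fun p q i j h => by exact_mod_cast hnγ p q i j h
    have hpos : ∀ c ∈ eigenvaluesOnMaximalIdeal χ', ∃ m : ℕ, 0 < m ∧ c = (m : k) := by
      intro c hc
      obtain ⟨p, i, hi, rfl⟩ := hχ'.exists_eq_mul_of_mem_eigenvalues hc
      exact ⟨n p * i, Nat.mul_pos (hn p) hi, by push_cast; rfl⟩
    refine ⟨χ', hχ'.generatesMaximalIdeal hA fun c hc => ?_, hχ'.isDiagonalizable hA, hpos⟩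
    obtain ⟨m, hm, rfl⟩ := hpos c hc
    exact Nat.cast_ne_zero.2 hm.ne'
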